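/- Let $N\ge 1$ and let $X=W^{1,2}(\mathbb{R}^N)\cap\{u:\int_{\mathbb{R}^N}|x|^2|u|^2\,dx<\infty\}$ (real-valued functions). Then for every $u\in X$, $$\int_{\mathbb{R}^N}|\nabla u|^2\,dx+\int_{\mathbb{R}^N}|x|^2|u|^2\,dx-N\int_{\mathbb{R}^N}|u|^2\,dx\ \ge\ 2\inf_{c\in\mathbb{R}}\int_{\mathbb{R}^N}\left|u-ce^{-\frac12|x|^2}\right|^2dx,$$ where $\nabla u$ is the weak gradient. The constant $2$ is sharp: if $C\in\mathbb{R}$ is such that the inequality with $C$ in place of $2$ holds for all $u\in X$, then $C\le 2$. Moreover, equality with constant $2$ is attained by the nontrivial function $u_1(x)=x_1e^{-\frac12|x|^2}$: it belongs to $X$, the infimum on the right-hand side for $u=u_1$ is positive, and both sides of the inequality are equal for $u=u_1$. -/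

import Mathlib

open MeasureTheory
open scoped ContDiff

noncomputable section

namespace HUP

/-- `g` is a weak (distributional) gradient of the real function `u` on `ℝ^N`: both are locally
integrable and `∫ u ∂ᵢφ = - ∫ gᵢ φ` for every test function `φ ∈ C_c^∞(ℝ^N)` and every `i`. -/
structure IsWeakGradient {N : ℕ} (u : EuclideanSpace ℝ (Fin N) → ℝ)
    (g : EuclideanSpace ℝ (Fin N) → EuclideanSpace ℝ (Fin N)) : Prop where
  locallyIntegrable_fun : LocallyIntegrable u
  locallyIntegrable_grad : LocallyIntegrable g
  integral_eq : ∀ φ : EuclideanSpace ℝ (Fin N) → ℝ, ContDiff ℝ ∞ φ → HasCompactSupport φ →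
    ∀ i : Fin N, ∫ x, u x * fderiv ℝ φ x (EuclideanSpace.single i 1) = - ∫ x, g x i * φ x

/-- The Sobolev space `W^{1,2}(ℝ^N)` of real functions: `u` and a weak gradient of `u` are
square integrable. -/
def MemW12 {N : ℕ} (u : EuclideanSpace ℝ (Fin N) → ℝ) : Prop :=
  MemLp u 2 ∧ ∃ g : EuclideanSpace ℝ (Fin N) → EuclideanSpace ℝ (Fin N),
    MemLp g 2 ∧ IsWeakGradient u g

/-- `X = W^{1,2}(ℝ^N) ∩ {u : ∫ |x|² |u|² dx < ∞}`. -/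
def X (N : ℕ) : Set (EuclideanSpace ℝ (Fin N) → ℝ) :=
  {u | MemW12 u ∧ Integrable (fun x => ‖x‖ ^ 2 * |u x| ^ 2)}

open Classical in
/-- The weak gradient of `u` (a representative of it; it is unique up to a null set, see
`IsWeakGradient.ae_eq`), with the default value `0` if `u` has none. -/
def weakGradient {N : ℕ} (u : EuclideanSpace ℝ (Fin N) → ℝ) :
    EuclideanSpace ℝ (Fin N) → EuclideanSpace ℝ (Fin N) :=
  if h : ∃ g, IsWeakGradient u g then h.choose else 0

/-- `∫ |∇u|² dx + ∫ |x|² |u|² dx - N ∫ |u|² dx`. -/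
def deficit {N : ℕ} (u : EuclideanSpace ℝ (Fin N) → ℝ) : ℝ :=
  (∫ x, ‖weakGradient u x‖ ^ 2) + (∫ x, ‖x‖ ^ 2 * |u x| ^ 2) - N * ∫ x, |u x| ^ 2

/-- `inf_{c ∈ ℝ} ∫ |u - c e^{-|x|²/2}|² dx`. -/
def gaussianDistSq {N : ℕ} (u : EuclideanSpace ℝ (Fin N) → ℝ) : ℝ :=
  ⨅ c : ℝ, ∫ x, |u x - c * Real.exp (-(1 / 2) * ‖x‖ ^ 2)| ^ 2

/-- Weak gradients are unique up to a null set. -/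
theorem IsWeakGradient.ae_eq {N : ℕ} {u : EuclideanSpace ℝ (Fin N) → ℝ}
    {g g' : EuclideanSpace ℝ (Fin N) → EuclideanSpace ℝ (Fin N)}
    (h : IsWeakGradient u g) (h' : IsWeakGradient u g') : g =ᵐ[volume] g' := by
  have coord : ∀ {f : EuclideanSpace ℝ (Fin N) → EuclideanSpace ℝ (Fin N)},
      LocallyIntegrable f → ∀ i, LocallyIntegrable (fun x => f x i) := by
    intro f hf i x
    obtain ⟨s, hs, hfs⟩ := hf x
    exact ⟨s, hs, (EuclideanSpace.proj (𝕜 := ℝ) i).integrable_comp hfs⟩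
  have key : ∀ i : Fin N, ∀ᵐ x, g x i = g' x i := by
    intro i
    refine ae_eq_of_integral_contDiff_smul_eq (coord h.locallyIntegrable_grad i)
      (coord h'.locallyIntegrable_grad i) ?_
    intro φ hφ hc
    have e := (h.integral_eq φ hφ hc i).symm.trans (h'.integral_eq φ hφ hc i)
    simpa [mul_comm] using e
  filter_upwards [ae_all_iff.2 key] with x hx
  ext i
  exact hx i

theorem isWeakGradient_weakGradient {N : ℕ} {u : EuclideanSpace ℝ (Fin N) → ℝ} (hu : MemW12 u) :
    IsWeakGradient u (weakGradient u) := by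
  have h : ∃ g, IsWeakGradient u g := hu.2.imp fun _ h => h.2
  rw [weakGradient, dif_pos h]
  exact h.choose_spec

theorem memLp_weakGradient {N : ℕ} {u : EuclideanSpace ℝ (Fin N) → ℝ} (hu : MemW12 u) :
    MemLp (weakGradient u) 2 := by
  obtain ⟨g, hg, hw⟩ := hu.2
  exact hg.ae_eq (hw.ae_eq (isWeakGradient_weakGradient hu))

end HUP

end

noncomputable section

namespace HUP

/-! Let G = e^{-|x|²/2}, Z = ∫ G², and write u = fG. Since 2∫ xᵢ u ∂ᵢu = -∫ u², the left side equals
Σᵢ ∫ (∂ᵢu + xᵢu)² (`integral_fderiv_add_mul_sq`), and ∂ᵢu + xᵢu = G ∂ᵢf. At the optimal c the right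
side is twice the unnormalised variance of f for the weight e^{-|x|²}. The claim is thus the
Poincaré inequality for this weight.

`gaussian_poincare` is proved by rotating independent copies. For independent X, Y with density
proportional to e^{-|x|²}, put X_θ = cos θ X + sin θ Y. The correlation of f(X) and f(X_θ) passes
from the second moment of f at θ = 0 to its squared mean at θ = π/2. Its derivative is -(sin θ / 2)
E[∇f(X)·∇f(X_θ)] (`hasDerivAt_integral_rotation`), which is at least -(sin θ / 2) E|∇f|² because X_θ
has the law of X; integrate over θ.

This settles test functions. A general u in X is approximated by `truncMollify`, whose energy is
asymptotically at most that of u, and Fatou's lemma passes to the limit (`exists_stability`).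

For u₁ = x₁G, ∂ᵢu₁ + xᵢu₁ is G if i = 1 and 0 otherwise, so the deficit is Z. Moreover u₁ is
orthogonal to G with ∫ u₁² = Z/2. Equality follows, and with it C ≤ 2. -/

/-! ### Integrability against Gaussian weights. -/

theorem integrable_exp_neg_mul_norm_sq {N : ℕ} {b : ℝ} (hb : 0 < b) :
    Integrable (fun x : EuclideanSpace ℝ (Fin N) => Real.exp (-b * ‖x‖ ^ 2)) := by
  have h := (GaussianFourier.integrable_cexp_neg_mul_sq_norm_add
    (V := EuclideanSpace ℝ (Fin N)) (b := (b : ℂ)) (by simpa using hb) 0 0).norm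
  refine h.congr (Filter.Eventually.of_forall fun x => ?_)
  simp only [Complex.norm_exp]
  norm_num
  left
  norm_cast

/-- From t^m / m! ≤ e^t at t = (1 + |x|²)/2, the polynomial costs only half of the exponent, and a
multiple of e^{-|x|²/2} dominates. -/
theorem integrable_mul_exp_neg_norm_sq {N : ℕ} {Φ : EuclideanSpace ℝ (Fin N) → ℝ}
    (hΦ : Continuous Φ) {C : ℝ} (m : ℕ) (hC : ∀ x, |Φ x| ≤ C * (1 + ‖x‖ ^ 2) ^ m) :
    Integrable (fun x => Φ x * Real.exp (-‖x‖ ^ 2)) := by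
  refine ((integrable_exp_neg_mul_norm_sq (N := N) (b := 1 / 2) (by norm_num)).const_mul
    (C * (2 ^ m * m.factorial * Real.exp (1 / 2)))).mono'
    (by fun_prop) (Filter.Eventually.of_forall fun x => ?_)
  have hC0 : 0 ≤ C := by
    have := (abs_nonneg _).trans (hC 0)
    simpa using this
  have h1 := Real.pow_div_factorial_le_exp ((1 + ‖x‖ ^ 2) / 2) (by positivity) m
  have h2 : (1 + ‖x‖ ^ 2) ^ m ≤
      2 ^ m * m.factorial * (Real.exp (1 / 2) * Real.exp (1 / 2 * ‖x‖ ^ 2)) := by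
    rw [← Real.exp_add]
    rw [div_pow, div_div, div_le_iff₀ (by positivity)] at h1
    calc _ ≤ _ := h1
      _ = _ := by ring_nf
  rw [Real.norm_eq_abs, abs_mul, Real.abs_exp]
  calc |Φ x| * Real.exp (-‖x‖ ^ 2)
      ≤ C * (2 ^ m * m.factorial * (Real.exp (1 / 2) * Real.exp (1 / 2 * ‖x‖ ^ 2))) *
          Real.exp (-‖x‖ ^ 2) := by
        gcongr
        exact (hC x).trans (by gcongr)
    _ = C * (2 ^ m * m.factorial * Real.exp (1 / 2)) *
        (Real.exp (1 / 2 * ‖x‖ ^ 2) * Real.exp (-‖x‖ ^ 2)) := by ring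
    _ = _ := by rw [← Real.exp_add]; ring_nf

/-! ### The product Gaussian and integration by parts. -/

/-- The density of the product of two copies of the Gaussian `e^{-|x|²} dx`. -/
def gaussPair {N : ℕ} (p : EuclideanSpace ℝ (Fin N) × EuclideanSpace ℝ (Fin N)) : ℝ :=
  Real.exp (-‖p.1‖ ^ 2) * Real.exp (-‖p.2‖ ^ 2)

variable {N : ℕ}

local notation "E" => EuclideanSpace ℝ (Fin N)

theorem gaussPair_pos (p : E × E) : 0 < gaussPair p := by unfold gaussPair; positivity

theorem continuous_gaussPair : Continuous (gaussPair : E × E → ℝ) := by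
  unfold gaussPair; fun_prop

theorem integrable_moment_gaussPair :
    Integrable (fun p : E × E => (1 + ‖p.1‖ ^ 2) * (1 + ‖p.2‖ ^ 2) * gaussPair p) := by
  have h : Integrable (fun x : E => (1 + ‖x‖ ^ 2) * Real.exp (-‖x‖ ^ 2)) :=
    integrable_mul_exp_neg_norm_sq (by fun_prop) (C := 1) 1 fun x => by
      rw [abs_of_nonneg (by positivity)]; simp
  refine (h.mul_prod h).congr (Filter.Eventually.of_forall fun p => ?_)
  simp only [gaussPair]; ring

/-- Replaces linear growth on the product by a bound that factors over the two variables. -/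
theorem one_add_norm_add_norm_le (p : E × E) :
    1 + ‖p.1‖ + ‖p.2‖ ≤ 2 * ((1 + ‖p.1‖ ^ 2) * (1 + ‖p.2‖ ^ 2)) := by
  nlinarith [sq_nonneg (‖p.1‖ - 1), sq_nonneg (‖p.2‖ - 1), sq_nonneg (‖p.1‖ * ‖p.2‖)]

theorem integrable_mul_gaussPair {Φ : E × E → ℝ} (hΦ : Continuous Φ) {C : ℝ}
    (hC : ∀ p, |Φ p| ≤ C * (1 + ‖p.1‖ + ‖p.2‖)) : Integrable (fun p => Φ p * gaussPair p) := by
  have hC0 : 0 ≤ C := by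
    have := (abs_nonneg _).trans (hC 0)
    simpa using this
  refine (integrable_moment_gaussPair.const_mul (C * 2)).mono'
    (hΦ.mul continuous_gaussPair).aestronglyMeasurable (Filter.Eventually.of_forall fun p => ?_)
  have hp := gaussPair_pos p
  rw [Real.norm_eq_abs, abs_mul, abs_of_pos hp]
  have := mul_le_mul_of_nonneg_left (one_add_norm_add_norm_le p) hC0
  calc |Φ p| * gaussPair p ≤ C * (2 * ((1 + ‖p.1‖ ^ 2) * (1 + ‖p.2‖ ^ 2))) * gaussPair p := by
        gcongr
        exact (hC p).trans this
    _ = _ := by ring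

theorem integrable_bounded_mul_gaussPair {Φ : E × E → ℝ} (hΦ : Continuous Φ) {C : ℝ}
    (hC : ∀ p, |Φ p| ≤ C) : Integrable (fun p => Φ p * gaussPair p) := by
  have hC0 : 0 ≤ C := (abs_nonneg _).trans (hC 0)
  refine integrable_mul_gaussPair hΦ (C := C) fun p => (hC p).trans ?_
  nlinarith [norm_nonneg p.1, norm_nonneg p.2]

theorem hasFDerivAt_gaussPair (p : E × E) :
    HasFDerivAt gaussPair ((-2 * gaussPair p) •
      ((innerSL ℝ p.1).comp (ContinuousLinearMap.fst ℝ E E) +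
        (innerSL ℝ p.2).comp (ContinuousLinearMap.snd ℝ E E))) p := by
  have h1 : HasFDerivAt (fun p : E × E => Real.exp (-‖p.1‖ ^ 2)) _ p :=
    ((hasFDerivAt_fst (p := p)).norm_sq.neg).exp
  have h2 : HasFDerivAt (fun p : E × E => Real.exp (-‖p.2‖ ^ 2)) _ p :=
    ((hasFDerivAt_snd (p := p)).norm_sq.neg).exp
  refine (h1.mul h2).congr_fderiv ?_
  ext v <;> simp [gaussPair] <;> ring

/-- Gaussian integration by parts. -/
theorem integral_mul_inner_gaussPair {Φ : E × E → ℝ} (hΦ : ContDiff ℝ 1 Φ) (v : E × E) {C : ℝ}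
    (hC : ∀ p, |Φ p| ≤ C) (hC' : ∀ p, |fderiv ℝ Φ p v| ≤ C) :
    ∫ p, Φ p * (inner ℝ p.1 v.1 + inner ℝ p.2 v.2) * gaussPair p =
      1 / 2 * ∫ p, fderiv ℝ Φ p v * gaussPair p := by
  have hC0 : 0 ≤ C := (abs_nonneg _).trans (hC 0)
  have : (volume : Measure (E × E)).IsAddHaarMeasure :=
    inferInstanceAs ((volume : Measure E).prod volume).IsAddHaarMeasure
  -- The weight e^{-|x|²} has logarithmic derivative -2⟨p, v⟩; this 2 is the source of the factor
  -- 1/2.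
  have hw : ∀ p : E × E, fderiv ℝ gaussPair p v =
      -2 * ((inner ℝ p.1 v.1 + inner ℝ p.2 v.2) * gaussPair p) := fun p => by
    rw [(hasFDerivAt_gaussPair p).fderiv]
    simp; ring
  have hi : Integrable fun p : E × E =>
      Φ p * (inner ℝ p.1 v.1 + inner ℝ p.2 v.2) * gaussPair p := by
    have := hΦ.continuous
    refine integrable_mul_gaussPair (by fun_prop) (C := C * (‖v.1‖ + ‖v.2‖)) fun p => ?_
    rw [abs_mul]
    have h1 := abs_real_inner_le_norm p.1 v.1
    have h2 := abs_real_inner_le_norm p.2 v.2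
    have h3 := abs_add_le (inner ℝ p.1 v.1) (inner ℝ p.2 v.2)
    rw [mul_assoc]
    refine mul_le_mul (hC p) ?_ (abs_nonneg _) hC0
    nlinarith [norm_nonneg p.1, norm_nonneg p.2, norm_nonneg v.1, norm_nonneg v.2,
      mul_nonneg (norm_nonneg p.1) (norm_nonneg v.2), mul_nonneg (norm_nonneg p.2) (norm_nonneg v.1)]
  have hibp := integral_mul_fderiv_eq_neg_fderiv_mul_of_integrable (μ := volume) (f := Φ)
    (g := gaussPair) (v := v)
    (integrable_bounded_mul_gaussPair
      ((hΦ.continuous_fderiv (by norm_num)).clm_apply continuous_const) hC')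
    (by
      refine (hi.const_mul (-2)).congr (Filter.Eventually.of_forall fun p => ?_)
      simp only [hw]; ring)
    (integrable_bounded_mul_gaussPair hΦ.continuous hC)
    (fun p _ => (hΦ.differentiable (by norm_num)) p)
    (fun p _ => (hasFDerivAt_gaussPair p).differentiableAt)
  have : ∫ p, Φ p * fderiv ℝ gaussPair p v =
      -2 * ∫ p, Φ p * (inner ℝ p.1 v.1 + inner ℝ p.2 v.2) * gaussPair p := by
    rw [← integral_const_mul]
    congr 1; ext p; rw [hw]; ring
  linarith

/-! ### Interpolation by rotating two independent Gaussians. -/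

theorem hasDerivAt_rotation (p : E × E) (θ : ℝ) :
    HasDerivAt (fun θ : ℝ => Real.cos θ • p.1 + Real.sin θ • p.2)
      (-Real.sin θ • p.1 + Real.cos θ • p.2) θ :=
  ((Real.hasDerivAt_cos θ).smul_const p.1).add ((Real.hasDerivAt_sin θ).smul_const p.2)

/-- The bound is uniform in θ, as the dominating function for differentiation under the integral
must be. -/
theorem norm_rotation_deriv_le (p : E × E) (θ : ℝ) :
    ‖-Real.sin θ • p.1 + Real.cos θ • p.2‖ ≤ ‖p.1‖ + ‖p.2‖ := by
  refine (norm_add_le _ _).trans (add_le_add ?_ ?_)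
  · rw [norm_smul, norm_neg]
    exact mul_le_of_le_one_left (norm_nonneg _) (Real.abs_sin_le_one θ)
  · rw [norm_smul]
    exact mul_le_of_le_one_left (norm_nonneg _) (Real.abs_cos_le_one θ)

theorem exists_bound_of_hasCompactSupport {V W : Type*} [TopologicalSpace V]
    [NormedAddCommGroup W] {f : V → W} (hf : Continuous f) (hc : HasCompactSupport f) :
    ∃ C, ∀ x, ‖f x‖ ≤ C := by
  obtain ⟨C, hC⟩ := hf.norm.bounded_above_of_compact_support hc.norm
  exact ⟨C, fun x => by simpa using hC x⟩

/-- The derivative along the rotation of two independent Gaussian variables. -/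
theorem hasDerivAt_integral_rotation {h F : E → ℝ} (hh : ContDiff ℝ 1 h) {A : ℝ}
    (hA : ∀ x, |h x| ≤ A) (hA' : ∀ x, ‖fderiv ℝ h x‖ ≤ A)
    (hF : ContDiff ℝ 2 F) (hFc : HasCompactSupport F) (θ : ℝ) :
    HasDerivAt
      (fun θ : ℝ => ∫ p : E × E, h p.1 * F (Real.cos θ • p.1 + Real.sin θ • p.2) * gaussPair p)
      (-(Real.sin θ / 2) * ∫ p : E × E, (∑ i, fderiv ℝ h p.1 (EuclideanSpace.single i 1) *
        fderiv ℝ F (Real.cos θ • p.1 + Real.sin θ • p.2) (EuclideanSpace.single i 1)) *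
          gaussPair p) θ := by
  have hA0 : 0 ≤ A := (abs_nonneg _).trans (hA 0)
  have hF1 : ContDiff ℝ 1 (fderiv ℝ F) := hF.fderiv_right (by norm_num)
  obtain ⟨B, hB⟩ := exists_bound_of_hasCompactSupport hF.continuous hFc
  obtain ⟨B', hB'⟩ := exists_bound_of_hasCompactSupport hF1.continuous (hFc.fderiv ℝ)
  have hB0 : 0 ≤ B' := (norm_nonneg _).trans (hB' 0)
  have hhc := hh.continuous
  have hh1 := hh.continuous_fderiv (by norm_num)
  have hFc' := hF.continuous
  have hFc1 := hF1.continuous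
  have hgc := continuous_gaussPair (N := N)
  have key := hasDerivAt_integral_of_dominated_loc_of_deriv_le (μ := (volume : Measure (E × E)))
    (F := fun θ p => h p.1 * F (Real.cos θ • p.1 + Real.sin θ • p.2) * gaussPair p)
    (F' := fun θ p => h p.1 * fderiv ℝ F (Real.cos θ • p.1 + Real.sin θ • p.2)
      (-Real.sin θ • p.1 + Real.cos θ • p.2) * gaussPair p)
    (x₀ := θ) (s := Set.univ)
    (bound := fun p => (A * B' * (‖p.1‖ + ‖p.2‖)) * gaussPair p) Filter.univ_mem
    (Filter.Eventually.of_forall fun t => Continuous.aestronglyMeasurable (by fun_prop))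
    (by
      refine integrable_bounded_mul_gaussPair (by fun_prop) (C := A * B) fun p => ?_
      rw [abs_mul]
      exact mul_le_mul (hA _) (hB _) (abs_nonneg _) hA0)
    (Continuous.aestronglyMeasurable (by fun_prop))
    (Filter.Eventually.of_forall fun p t _ => by
      rw [Real.norm_eq_abs, abs_mul, abs_of_pos (gaussPair_pos p), abs_mul, mul_assoc A]
      refine mul_le_mul_of_nonneg_right (mul_le_mul (hA _) ?_ (abs_nonneg _) hA0)
        (gaussPair_pos p).le
      refine ((fderiv ℝ F (Real.cos t • p.1 + Real.sin t • p.2)).le_opNorm _).trans ?_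
      exact mul_le_mul (hB' _) (norm_rotation_deriv_le p t) (norm_nonneg _) hB0)
    (by
      refine integrable_mul_gaussPair (by fun_prop) (C := A * B') fun p => ?_
      rw [abs_of_nonneg (by positivity)]
      gcongr
      linarith)
    (Filter.Eventually.of_forall fun p t _ => by
      have := ((hF.differentiable (by norm_num)) _).hasFDerivAt.comp_hasDerivAt t
        (hasDerivAt_rotation p t)
      exact (this.const_mul (h p.1)).mul_const (gaussPair p))
  refine key.2.congr_deriv ?_
  set c := Real.cos θ with hc
  set s := Real.sin θ with hs
  have hpart : ∀ i : Fin N,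
      ∫ p : E × E, h p.1 * fderiv ℝ F (c • p.1 + s • p.2) (EuclideanSpace.single i 1) *
        (-s * p.1 i + c * p.2 i) * gaussPair p =
      -(s / 2) * ∫ p : E × E, (fderiv ℝ h p.1 (EuclideanSpace.single i 1) *
        fderiv ℝ F (c • p.1 + s • p.2) (EuclideanSpace.single i 1)) * gaussPair p := by
    intro i
    set e : E := EuclideanSpace.single i 1 with he
    have hne : ‖e‖ = 1 := by simp [he]
    -- This direction is the coefficient vector of the i-th coordinate of dX_θ/dθ, and it lies in
    -- the kernel of p ↦ X_θ. Integration by parts along v therefore differentiates only h and needs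
    -- no second derivative of F.
    set v : E × E := (-s • e, c • e) with hv
    set L : E × E →L[ℝ] E :=
      c • ContinuousLinearMap.fst ℝ E E + s • ContinuousLinearMap.snd ℝ E E with hL
    have hLv : L v = 0 := by
      simp only [hL, hv, add_apply, smul_apply,
        ContinuousLinearMap.coe_fst', ContinuousLinearMap.coe_snd', smul_smul, ← add_smul]
      rw [show c * -s + s * c = 0 by ring, zero_smul]
    have hG : ContDiff ℝ 1 (fun x => fderiv ℝ F x e) := hF1.clm_apply contDiff_const
    have hd : ∀ p : E × E, HasFDerivAt (fun p : E × E => h p.1 * fderiv ℝ F (L p) e)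
        (h p.1 • (fderiv ℝ (fun x => fderiv ℝ F x e) (L p)).comp L +
          fderiv ℝ F (L p) e • (fderiv ℝ h p.1).comp (ContinuousLinearMap.fst ℝ E E)) p := by
      intro p
      have h1 : HasFDerivAt (fun p : E × E => h p.1) _ p :=
        ((hh.differentiable (by norm_num)) p.1).hasFDerivAt.comp p hasFDerivAt_fst
      have h2 : HasFDerivAt (fun p : E × E => fderiv ℝ F (L p) e) _ p :=
        ((hG.differentiable (by norm_num)) (L p)).hasFDerivAt.comp p L.hasFDerivAt
      exact h1.mul h2
    have hdv : ∀ p : E × E, fderiv ℝ (fun p : E × E => h p.1 * fderiv ℝ F (L p) e) p v =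
        -s * (fderiv ℝ h p.1 e * fderiv ℝ F (L p) e) := by
      intro p
      rw [(hd p).fderiv]
      simp [hLv]
      simp [hv]
      ring
    have hb1 : ∀ p : E × E, |fderiv ℝ F (L p) e| ≤ B' := fun p => by
      simpa [hne] using (ContinuousLinearMap.le_of_opNorm_le _ (hB' (L p)) e)
    have hb2 : ∀ p : E × E, |fderiv ℝ h p.1 e| ≤ A := fun p => by
      simpa [hne] using (ContinuousLinearMap.le_of_opNorm_le _ (hA' p.1) e)
    have hs1 : |s| ≤ 1 := Real.abs_sin_le_one θ
    have hI := integral_mul_inner_gaussPair (Φ := fun p : E × E => h p.1 * fderiv ℝ F (L p) e)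
      ((hh.comp contDiff_fst).mul (hG.comp L.contDiff)) v (C := A * B')
      (fun p => by
        rw [abs_mul]
        exact mul_le_mul (hA _) (hb1 p) (abs_nonneg _) hA0)
      (fun p => by
        rw [hdv, abs_mul, abs_neg, abs_mul, ← one_mul (A * B')]
        exact mul_le_mul hs1 (mul_le_mul (hb2 p) (hb1 p) (abs_nonneg _) hA0) (by positivity)
          zero_le_one)
    simp only [hdv, mul_assoc (-s), integral_const_mul] at hI
    calc _ = _ := by
          congr 1
          ext p
          simp [hv, inner_smul_right, he, EuclideanSpace.inner_single_right, hL]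
      _ = _ := hI
      _ = _ := by
          simp only [hL]
          simp only [add_apply, smul_apply,
            ContinuousLinearMap.coe_fst', ContinuousLinearMap.coe_snd']
          ring
  have hbd : ∀ p : E × E, ∀ i : Fin N,
      |fderiv ℝ F (c • p.1 + s • p.2) (EuclideanSpace.single i 1)| ≤ B' := fun p i => by
    simpa using (ContinuousLinearMap.le_of_opNorm_le _ (hB' (c • p.1 + s • p.2))
      (EuclideanSpace.single i (1 : ℝ)))
  have hbd2 : ∀ p : E × E, ∀ i : Fin N,
      |fderiv ℝ h p.1 (EuclideanSpace.single i 1)| ≤ A := fun p i => by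
    simpa using (ContinuousLinearMap.le_of_opNorm_le _ (hA' p.1)
      (EuclideanSpace.single i (1 : ℝ)))
  have hR : ∫ p : E × E, (∑ i, fderiv ℝ h p.1 (EuclideanSpace.single i 1) *
        fderiv ℝ F (c • p.1 + s • p.2) (EuclideanSpace.single i 1)) * gaussPair p =
      ∑ i, ∫ p : E × E, (fderiv ℝ h p.1 (EuclideanSpace.single i 1) *
        fderiv ℝ F (c • p.1 + s • p.2) (EuclideanSpace.single i 1)) * gaussPair p := by
    simp only [Finset.sum_mul]
    refine integral_finsetSum _ fun i _ => ?_
    refine integrable_bounded_mul_gaussPair (by fun_prop) (C := A * B') fun p => ?_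
    rw [abs_mul]
    exact mul_le_mul (hbd2 p i) (hbd p i) (abs_nonneg _) hA0
  rw [hR, Finset.mul_sum]
  simp only [← hpart]
  rw [← integral_finsetSum]
  · congr 1
    ext p
    rw [← Finset.sum_mul]
    congr 1
    have hexp : -s • p.1 + c • p.2 =
        ∑ i, (-s * p.1 i + c * p.2 i) • (EuclideanSpace.single i (1 : ℝ) : E) := by
      ext j
      simp [Finset.sum_apply, Pi.single_apply]
    rw [hexp, map_sum, Finset.mul_sum]
    refine Finset.sum_congr rfl fun i _ => ?_
    rw [map_smul, smul_eq_mul]; ring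
  · intro i _
    refine integrable_mul_gaussPair (by fun_prop) (C := A * B') fun p => ?_
    rw [abs_mul, abs_mul]
    refine mul_le_mul (mul_le_mul (hA _) (hbd p i) (abs_nonneg _) hA0) ?_ (abs_nonneg _)
      (by positivity)
    have h1 : |-s * p.1 i + c * p.2 i| ≤ ‖p.1‖ + ‖p.2‖ := by
      have h := (PiLp.norm_apply_le (-s • p.1 + c • p.2) i).trans (norm_rotation_deriv_le p θ)
      simpa using h
    linarith

/-! ### The Gaussian Poincaré inequality. -/

theorem integral_mul_gaussPair (f g : E → ℝ) :
    ∫ p : E × E, f p.1 * g p.2 * gaussPair p =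
      (∫ x, f x * Real.exp (-‖x‖ ^ 2)) * ∫ x, g x * Real.exp (-‖x‖ ^ 2) := by
  rw [← integral_prod_mul, ← Measure.volume_eq_prod]
  congr 1; ext p; simp only [gaussPair]; ring

/-- Rotation invariance of the product of two Gaussians. -/
theorem integral_comp_rotation {F : E → ℝ} (hF : ContDiff ℝ 2 F) (hFc : HasCompactSupport F)
    (θ : ℝ) :
    ∫ p : E × E, F (Real.cos θ • p.1 + Real.sin θ • p.2) * gaussPair p =
      (∫ x, F x * Real.exp (-‖x‖ ^ 2)) * ∫ x : E, Real.exp (-‖x‖ ^ 2) := by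
  -- With h = 1 the derivative formula contains ∇h = 0, so the integral is constant in θ; no change
  -- of variables is needed.
  have hd : ∀ t : ℝ, HasDerivAt
      (fun θ : ℝ => ∫ p : E × E, F (Real.cos θ • p.1 + Real.sin θ • p.2) * gaussPair p) 0 t := by
    intro t
    have := hasDerivAt_integral_rotation (h := fun _ : E => (1 : ℝ)) (A := 1) contDiff_const
      (by simp) (by simp) hF hFc t
    simpa using this
  have hc := is_const_of_deriv_eq_zero (fun t => (hd t).differentiableAt) (fun t => (hd t).deriv)
    θ 0
  refine hc.trans ?_
  have := integral_mul_gaussPair F (fun _ => 1)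
  simpa using this

/-- The Gaussian Poincaré inequality for the measure `e^{-|x|²} dx`. -/
theorem gaussian_poincare {f : E → ℝ} (hf : ContDiff ℝ ∞ f) (hfc : HasCompactSupport f) :
    (∫ x : E, Real.exp (-‖x‖ ^ 2)) * (∫ x, f x ^ 2 * Real.exp (-‖x‖ ^ 2)) -
      (∫ x : E, Real.exp (-‖x‖ ^ 2)) / 2 *
        (∫ x, (∑ i, fderiv ℝ f x (EuclideanSpace.single i 1) ^ 2) * Real.exp (-‖x‖ ^ 2)) ≤
      (∫ x, f x * Real.exp (-‖x‖ ^ 2)) ^ 2 := by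
  set Z := ∫ x : E, Real.exp (-‖x‖ ^ 2) with hZ
  set D : E → ℝ := fun x => ∑ i, fderiv ℝ f x (EuclideanSpace.single i 1) ^ 2 with hD
  have hf1 : ContDiff ℝ ∞ (fderiv ℝ f) := hf.fderiv_right (by simp)
  have hf1c := hf1.continuous
  have hDs : ContDiff ℝ 2 D := by
    refine ContDiff.sum fun i _ => ContDiff.pow ?_ 2
    exact_mod_cast contDiff_infty.1 (hf1.clm_apply contDiff_const) 2
  have hDc : HasCompactSupport D := by
    refine (hfc.fderiv ℝ).comp_left (g := fun A : E →L[ℝ] ℝ =>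
      ∑ i, A (EuclideanSpace.single i 1) ^ 2) ?_
    simp
  obtain ⟨A₀, hA₀⟩ := exists_bound_of_hasCompactSupport hf.continuous hfc
  obtain ⟨A₁, hA₁⟩ := exists_bound_of_hasCompactSupport hf1.continuous (hfc.fderiv ℝ)
  obtain ⟨B, hB⟩ := exists_bound_of_hasCompactSupport hDs.continuous hDc
  set ψ : ℝ → ℝ := fun θ =>
    ∫ p : E × E, f p.1 * f (Real.cos θ • p.1 + Real.sin θ • p.2) * gaussPair p with hψ
  have hder := fun θ => hasDerivAt_integral_rotation (h := f) (A := max A₀ A₁)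
    (hf.of_le (by exact_mod_cast le_top))
    (fun x => (hA₀ x).trans (le_max_left _ _)) (fun x => (hA₁ x).trans (le_max_right _ _))
    (by exact_mod_cast contDiff_infty.1 hf 2) hfc θ
  have hbound : ∀ θ : ℝ, ∫ p : E × E, (∑ i, fderiv ℝ f p.1 (EuclideanSpace.single i 1) *
      fderiv ℝ f (Real.cos θ • p.1 + Real.sin θ • p.2) (EuclideanSpace.single i 1)) *
        gaussPair p ≤ (∫ x, D x * Real.exp (-‖x‖ ^ 2)) * Z := by
    intro θ
    have hDcont := hDs.continuous
    have hi1 : Integrable fun p : E × E => D p.1 * gaussPair p :=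
      integrable_bounded_mul_gaussPair (by fun_prop) fun p => hB p.1
    have hi2 : Integrable fun p : E × E =>
        D (Real.cos θ • p.1 + Real.sin θ • p.2) * gaussPair p :=
      integrable_bounded_mul_gaussPair (by fun_prop) fun p => hB _
    have h1 : ∫ p : E × E, D p.1 * gaussPair p = (∫ x, D x * Real.exp (-‖x‖ ^ 2)) * Z := by
      have := integral_mul_gaussPair D (fun _ => 1)
      simpa using this
    have h2 := integral_comp_rotation hDs hDc θ
    -- By rotation invariance both halves of the AM-GM majorant have the same integral.
    have h3 : ∫ p : E × E, (D p.1 * gaussPair p +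
        D (Real.cos θ • p.1 + Real.sin θ • p.2) * gaussPair p) / 2 =
        (∫ x, D x * Real.exp (-‖x‖ ^ 2)) * Z := by
      rw [integral_div, integral_add hi1 hi2, h1, h2]; ring
    rw [← h3]
    have hpt : ∀ p : E × E, |∑ i, fderiv ℝ f p.1 (EuclideanSpace.single i 1) *
        fderiv ℝ f (Real.cos θ • p.1 + Real.sin θ • p.2) (EuclideanSpace.single i 1)| ≤
        (D p.1 + D (Real.cos θ • p.1 + Real.sin θ • p.2)) / 2 := by
      intro p
      simp only [hD, ← Finset.sum_add_distrib, Finset.sum_div]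
      refine (Finset.abs_sum_le_sum_abs _ _).trans (Finset.sum_le_sum fun i _ => ?_)
      rw [abs_le]
      constructor <;> nlinarith [sq_nonneg (fderiv ℝ f p.1 (EuclideanSpace.single i 1) -
        fderiv ℝ f (Real.cos θ • p.1 + Real.sin θ • p.2) (EuclideanSpace.single i 1)),
        sq_nonneg (fderiv ℝ f p.1 (EuclideanSpace.single i 1) +
        fderiv ℝ f (Real.cos θ • p.1 + Real.sin θ • p.2) (EuclideanSpace.single i 1))]
    refine integral_mono ?_ ((hi1.add hi2).div_const 2) fun p => ?_
    · refine integrable_bounded_mul_gaussPair (by fun_prop) (C := B) fun p => (hpt p).trans ?_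
      have := (le_abs_self _).trans (hB p.1)
      have := (le_abs_self _).trans (hB (Real.cos θ • p.1 + Real.sin θ • p.2))
      linarith
    · have := mul_le_mul_of_nonneg_right ((le_abs_self _).trans (hpt p)) (gaussPair_pos p).le
      simp only
      linarith
  set K := (∫ x, D x * Real.exp (-‖x‖ ^ 2)) * Z with hK
  -- The lower bound ψ' ≥ -(K/2) sin θ in integrated form; comparing the endpoints 0 and π/2 gives
  -- the inequality.
  have hmono : MonotoneOn (fun θ => ψ θ - K / 2 * Real.cos θ) (Set.Icc 0 (Real.pi / 2)) := by
    have hd : ∀ θ, HasDerivAt (fun θ => ψ θ - K / 2 * Real.cos θ) _ θ := fun θ =>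
      (hder θ).sub ((Real.hasDerivAt_cos θ).const_mul (K / 2))
    refine monotoneOn_of_deriv_nonneg (convex_Icc _ _)
      (fun θ _ => (hd θ).continuousAt.continuousWithinAt)
      (fun θ _ => (hd θ).differentiableAt.differentiableWithinAt) fun θ hθ => ?_
    rw [interior_Icc] at hθ
    rw [(hd θ).deriv]
    have hs : 0 ≤ Real.sin θ := Real.sin_nonneg_of_nonneg_of_le_pi hθ.1.le (by linarith [hθ.2, Real.pi_pos])
    nlinarith [mul_le_mul_of_nonneg_left (hbound θ) hs]
  have hπ : (0 : ℝ) ≤ Real.pi / 2 := by positivity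
  have hfin := hmono (Set.left_mem_Icc.2 hπ) (Set.right_mem_Icc.2 hπ) hπ
  have e0 : ψ 0 = (∫ x, f x ^ 2 * Real.exp (-‖x‖ ^ 2)) * Z := by
    have := integral_mul_gaussPair (fun x => f x ^ 2) (fun _ => 1)
    simp only [mul_one, one_mul] at this
    rw [← this]
    simp [hψ, sq]
  have e1 : ψ (Real.pi / 2) = (∫ x, f x * Real.exp (-‖x‖ ^ 2)) ^ 2 := by
    rw [sq, ← integral_mul_gaussPair]
    simp [hψ]
  simp only [e0, e1, Real.cos_zero, Real.cos_pi_div_two] at hfin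
  linarith

/-! ### From Poincaré to the stability inequality for test functions. -/

/-- The weighted energy of one coordinate is a square. -/
theorem integral_fderiv_add_mul_sq {u : E → ℝ} (hu : ContDiff ℝ 1 u) (i : Fin N)
    (h0 : Integrable fun x => u x ^ 2) (hx : Integrable fun x => (x i * u x) ^ 2)
    (hd : Integrable fun x => fderiv ℝ u x (EuclideanSpace.single i 1) ^ 2) :
    ∫ x, (fderiv ℝ u x (EuclideanSpace.single i 1) + x i * u x) ^ 2 =
      (∫ x, fderiv ℝ u x (EuclideanSpace.single i 1) ^ 2) + (∫ x, (x i * u x) ^ 2) -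
        ∫ x, u x ^ 2 := by
  have huc := hu.continuous
  have hu1 := hu.continuous_fderiv (by norm_num)
  have hprod : ∀ {a b : E → ℝ}, Continuous a → Continuous b → Integrable (fun x => a x ^ 2) →
      Integrable (fun x => b x ^ 2) → Integrable (fun x => a x * b x) := by
    intro a b ha hb ha2 hb2
    have := MemLp.integrable_mul ((memLp_two_iff_integrable_sq ha.aestronglyMeasurable).2 ha2)
      ((memLp_two_iff_integrable_sq hb.aestronglyMeasurable).2 hb2)
    exact this
  have hxd : Integrable fun x => x i * u x * fderiv ℝ u x (EuclideanSpace.single i 1) :=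
    hprod (by fun_prop) (by fun_prop) hx hd
  have hxu : Integrable fun x => x i * u x * u x := hprod (by fun_prop) (by fun_prop) hx h0
  have hfd : ∀ x : E, HasFDerivAt (fun x : E => x i * u x)
      (x i • fderiv ℝ u x + u x • (EuclideanSpace.proj i : E →L[ℝ] ℝ)) x := fun x =>
    (EuclideanSpace.proj i : E →L[ℝ] ℝ).hasFDerivAt.mul
      ((hu.differentiable (by norm_num)) x).hasFDerivAt
  have hfd' : ∀ x : E, fderiv ℝ (fun x : E => x i * u x) x (EuclideanSpace.single i 1) * u x =
      x i * u x * fderiv ℝ u x (EuclideanSpace.single i 1) + u x ^ 2 := fun x => by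
    rw [(hfd x).fderiv]; simp; ring
  -- Integration by parts makes the cross integral reappear with the opposite sign, so it equals -½∫
  -- u². Only integrability is required, so that the identity also covers Gaussian functions.
  have hibp := integral_mul_fderiv_eq_neg_fderiv_mul_of_integrable (μ := volume)
    (f := fun x : E => x i * u x) (g := u) (v := EuclideanSpace.single i 1)
    (by simp only [hfd']; exact hxd.add h0) hxd hxu
    (fun x _ => (hfd x).differentiableAt) (fun x _ => (hu.differentiable (by norm_num)) x)
  simp only [hfd'] at hibp
  rw [integral_add hxd h0] at hibp
  have hexp : ∀ x : E, (fderiv ℝ u x (EuclideanSpace.single i 1) + x i * u x) ^ 2 =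
      fderiv ℝ u x (EuclideanSpace.single i 1) ^ 2 + (x i * u x) ^ 2 +
        2 * (x i * u x * fderiv ℝ u x (EuclideanSpace.single i 1)) := fun x => by ring
  simp only [hexp]
  have hdx : Integrable fun x : E =>
      fderiv ℝ u x (EuclideanSpace.single i 1) ^ 2 + (x i * u x) ^ 2 := hd.add hx
  rw [integral_add hdx (hxd.const_mul 2), integral_add hd hx, integral_const_mul]
  linarith

theorem exp_half_sq (x : E) :
    Real.exp (-(1 / 2) * ‖x‖ ^ 2) ^ 2 = Real.exp (-‖x‖ ^ 2) := by
  rw [← Real.exp_nat_mul]; congr 1; push_cast; ring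

theorem integral_exp_neg_norm_sq_pos : 0 < ∫ x : E, Real.exp (-‖x‖ ^ 2) := by
  have h := integrable_exp_neg_mul_norm_sq (N := N) (b := 1) one_pos
  simp only [neg_mul, one_mul] at h
  exact integral_exp_pos h

theorem norm_sq_mul_sq (x : E) (t : ℝ) : ‖x‖ ^ 2 * t ^ 2 = ∑ i, (x i * t) ^ 2 := by
  simp [EuclideanSpace.norm_sq_eq, Finset.sum_mul, mul_pow]

/-- Conjugation by the Gaussian turns ∂ᵢ into ∂ᵢ + xᵢ; this links the Poincaré energy to the
deficit. -/
theorem fderiv_mul_exp_half_sq {u : E → ℝ} {x : E} (hu : DifferentiableAt ℝ u x) (i : Fin N) :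
    fderiv ℝ (fun x => u x * Real.exp (1 / 2 * ‖x‖ ^ 2)) x (EuclideanSpace.single i 1) *
      Real.exp (-(1 / 2) * ‖x‖ ^ 2) =
      fderiv ℝ u x (EuclideanSpace.single i 1) + x i * u x := by
  have h1 : HasFDerivAt (fun x : E => Real.exp (1 / 2 * ‖x‖ ^ 2)) _ x :=
    (((hasFDerivAt_id x).norm_sq).const_mul (1 / 2)).exp
  have h2 : HasFDerivAt (fun x => u x * Real.exp (1 / 2 * ‖x‖ ^ 2)) _ x :=
    hu.hasFDerivAt.mul h1
  rw [h2.fderiv]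
  have h3 : Real.exp (1 / 2 * ‖x‖ ^ 2) * Real.exp (-(1 / 2) * ‖x‖ ^ 2) = 1 := by
    rw [← Real.exp_add]; ring_nf; simp
  simp [EuclideanSpace.inner_single_right] at h3 ⊢
  linear_combination (fderiv ℝ u x (EuclideanSpace.single i 1) + x i * u x) * h3

theorem integrable_exp_half_sq :
    Integrable fun x : E => Real.exp (-(1 / 2) * ‖x‖ ^ 2) ^ 2 := by
  have := integrable_exp_neg_mul_norm_sq (N := N) (b := 1) one_pos
  simp only [neg_mul (1 : ℝ), one_mul] at this
  simpa only [exp_half_sq] using this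

theorem integral_sub_mul_exp_half_sq {u : E → ℝ} (c : ℝ) (h0 : Integrable fun x => u x ^ 2)
    (hG : Integrable fun x => u x * Real.exp (-(1 / 2) * ‖x‖ ^ 2)) :
    ∫ x, (u x - c * Real.exp (-(1 / 2) * ‖x‖ ^ 2)) ^ 2 =
      (∫ x, u x ^ 2) - 2 * c * (∫ x, u x * Real.exp (-(1 / 2) * ‖x‖ ^ 2)) +
        c ^ 2 * ∫ x : E, Real.exp (-‖x‖ ^ 2) := by
  have h : ∀ x, (u x - c * Real.exp (-(1 / 2) * ‖x‖ ^ 2)) ^ 2 =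
      u x ^ 2 - 2 * c * (u x * Real.exp (-(1 / 2) * ‖x‖ ^ 2)) +
        c ^ 2 * Real.exp (-(1 / 2) * ‖x‖ ^ 2) ^ 2 := fun x => by ring
  have h1 : Integrable fun x => u x ^ 2 - 2 * c * (u x * Real.exp (-(1 / 2) * ‖x‖ ^ 2)) :=
    h0.sub (hG.const_mul _)
  simp only [h]
  rw [integral_add h1 (integrable_exp_half_sq.const_mul _), integral_sub h0 (hG.const_mul _),
    integral_const_mul, integral_const_mul]
  simp only [exp_half_sq]

theorem integral_sum_fderiv_add_mul_sq {u : E → ℝ} (hu : ContDiff ℝ 1 u)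
    (h0 : Integrable fun x => u x ^ 2) (hx : ∀ i, Integrable fun x => (x i * u x) ^ 2)
    (hd : ∀ i, Integrable fun x => fderiv ℝ u x (EuclideanSpace.single i 1) ^ 2) :
    ∑ i, ∫ x, (fderiv ℝ u x (EuclideanSpace.single i 1) + x i * u x) ^ 2 =
      (∫ x, ∑ i, fderiv ℝ u x (EuclideanSpace.single i 1) ^ 2) + (∫ x, ‖x‖ ^ 2 * u x ^ 2) -
        N * ∫ x, u x ^ 2 := by
  simp only [norm_sq_mul_sq]
  rw [integral_finsetSum _ fun i _ => hd i, integral_finsetSum _ fun i _ => hx i]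
  simp only [fun i => integral_fderiv_add_mul_sq hu i h0 (hx i) (hd i)]
  simp [Finset.sum_add_distrib, Finset.sum_sub_distrib]

/-- The Gaussian Poincaré inequality for `u e^{|x|²/2}`. -/
theorem gaussian_poincare_mul_exp {u : E → ℝ} (hu : ContDiff ℝ ∞ u) (huc : HasCompactSupport u) :
    (∫ x : E, Real.exp (-‖x‖ ^ 2)) * (∫ x, u x ^ 2) -
      (∫ x : E, Real.exp (-‖x‖ ^ 2)) / 2 *
        (∫ x, ∑ i, (fderiv ℝ u x (EuclideanSpace.single i 1) + x i * u x) ^ 2) ≤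
      (∫ x, u x * Real.exp (-(1 / 2) * ‖x‖ ^ 2)) ^ 2 := by
  have hexp : ContDiff ℝ ∞ fun x : E => Real.exp (1 / 2 * ‖x‖ ^ 2) :=
    (contDiff_const.mul (contDiff_norm_sq ℝ)).exp
  -- The growing factor e^{|x|²/2} is harmless because u has compact support.
  have hp := gaussian_poincare (hu.mul hexp) (huc.mul_right (f' := fun x : E =>
    Real.exp (1 / 2 * ‖x‖ ^ 2)))
  have h1 : ∀ x : E, Real.exp (1 / 2 * ‖x‖ ^ 2) * Real.exp (-(1 / 2) * ‖x‖ ^ 2) = 1 := fun x => by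
    rw [← Real.exp_add, neg_mul, add_neg_cancel, Real.exp_zero]
  have hd := hu.differentiable (by simp)
  have e1 : ∀ x, (u x * Real.exp (1 / 2 * ‖x‖ ^ 2)) ^ 2 * Real.exp (-‖x‖ ^ 2) = u x ^ 2 :=
    fun x => by rw [← exp_half_sq, ← mul_pow, mul_assoc, h1, mul_one]
  have e2 : ∀ x, u x * Real.exp (1 / 2 * ‖x‖ ^ 2) * Real.exp (-‖x‖ ^ 2) =
      u x * Real.exp (-(1 / 2) * ‖x‖ ^ 2) := fun x => by
    rw [← exp_half_sq]
    linear_combination u x * Real.exp (-(1 / 2) * ‖x‖ ^ 2) * h1 x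
  have e3 : ∀ x, (∑ i, fderiv ℝ (fun x => u x * Real.exp (1 / 2 * ‖x‖ ^ 2)) x
      (EuclideanSpace.single i 1) ^ 2) * Real.exp (-‖x‖ ^ 2) =
      ∑ i, (fderiv ℝ u x (EuclideanSpace.single i 1) + x i * u x) ^ 2 := fun x => by
    rw [← exp_half_sq, Finset.sum_mul]
    refine Finset.sum_congr rfl fun i _ => ?_
    rw [← fderiv_mul_exp_half_sq (hd x) i, mul_pow]
  simp only [e1, e2, e3] at hp
  exact hp

theorem integrable_sq_of_hasCompactSupport {a : E → ℝ} (ha : Continuous a)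
    (hc : HasCompactSupport a) : Integrable fun x => a x ^ 2 := by
  simp only [sq]
  have h : HasCompactSupport fun x => a x * a x := hc.mul_right
  exact Continuous.integrable_of_hasCompactSupport (by fun_prop) h

/-- The stability inequality for test functions. -/
theorem stability_of_hasCompactSupport {u : E → ℝ} (hu : ContDiff ℝ ∞ u)
    (huc : HasCompactSupport u) :
    2 * (∫ x, (u x - (∫ y, u y * Real.exp (-(1 / 2) * ‖y‖ ^ 2)) /
        (∫ y : E, Real.exp (-‖y‖ ^ 2)) * Real.exp (-(1 / 2) * ‖x‖ ^ 2)) ^ 2) + N * ∫ x, u x ^ 2 ≤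
      (∫ x, ∑ i, fderiv ℝ u x (EuclideanSpace.single i 1) ^ 2) + ∫ x, ‖x‖ ^ 2 * u x ^ 2 := by
  have hp := gaussian_poincare_mul_exp hu huc
  have hu1 : ContDiff ℝ 1 u := by exact_mod_cast contDiff_infty.1 hu 1
  have hucont := hu.continuous
  have hu1c := hu1.continuous_fderiv one_ne_zero
  have hI0 : Integrable fun x => u x ^ 2 := integrable_sq_of_hasCompactSupport hucont huc
  have hcx : ∀ i : Fin N, HasCompactSupport fun x : E => x i * u x := fun i => huc.mul_left
  have hcd : ∀ i : Fin N, HasCompactSupport fun x => fderiv ℝ u x (EuclideanSpace.single i 1) :=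
    fun i => huc.fderiv_apply ℝ _
  have hIx : ∀ i : Fin N, Integrable fun x => (x i * u x) ^ 2 := fun i =>
    integrable_sq_of_hasCompactSupport (by fun_prop) (hcx i)
  have hId : ∀ i : Fin N, Integrable fun x => fderiv ℝ u x (EuclideanSpace.single i 1) ^ 2 :=
    fun i => integrable_sq_of_hasCompactSupport (by fun_prop) (hcd i)
  have hIa : ∀ i : Fin N,
      Integrable fun x => (fderiv ℝ u x (EuclideanSpace.single i 1) + x i * u x) ^ 2 :=
    fun i => integrable_sq_of_hasCompactSupport (by fun_prop) ((hcd i).add (hcx i))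
  rw [integral_finsetSum _ fun i _ => hIa i, integral_sum_fderiv_add_mul_sq hu1 hI0 hIx hId] at hp
  have hIG : Integrable fun x => u x * Real.exp (-(1 / 2) * ‖x‖ ^ 2) := by
    have hc : HasCompactSupport fun x => u x * Real.exp (-(1 / 2) * ‖x‖ ^ 2) := huc.mul_right
    exact Continuous.integrable_of_hasCompactSupport (by fun_prop) hc
  rw [integral_sub_mul_exp_half_sq _ hI0 hIG]
  have hZ0 := integral_exp_neg_norm_sq_pos (N := N)
  generalize (∫ x : E, Real.exp (-‖x‖ ^ 2)) = Z at *
  generalize (∫ x : E, u x * Real.exp (-(1 / 2) * ‖x‖ ^ 2)) = M at *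
  -- M / Z is the coefficient of the orthogonal projection of u on the Gaussian; the projection has
  -- squared norm M² / Z.
  have hM : 2 * (M / Z) * M - (M / Z) ^ 2 * Z = M ^ 2 / Z := by field_simp; ring
  have hZM : Z * (M ^ 2 / Z) = M ^ 2 := by field_simp
  refine le_of_mul_le_mul_left ?_ hZ0
  linear_combination 2 * hp - 2 * Z * hM - 2 * hZM

/-! ### Mollification and its weighted L² bounds. -/

/-- The mollification of `a` by the normalized bump function `φ`. -/
def mollify (φ : ContDiffBump (0 : E)) (a : E → ℝ) : E → ℝ :=
  convolution (φ.normed volume) a (ContinuousLinearMap.lsmul ℝ ℝ) volume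

theorem mollify_apply (φ : ContDiffBump (0 : E)) (a : E → ℝ) (x : E) :
    mollify φ a x = ∫ t, φ.normed volume (x - t) * a t :=
  convolution_lsmul_swap

theorem integrable_normed_sub_mul (φ : ContDiffBump (0 : E)) {a : E → ℝ}
    (ha : LocallyIntegrable a) (x : E) : Integrable fun t => φ.normed volume (x - t) * a t :=
  (φ.hasCompactSupport_normed.convolutionExists_left (ContinuousLinearMap.lsmul ℝ ℝ)
    φ.continuous_normed ha x).integrable_swap

theorem contDiff_mollify (φ : ContDiffBump (0 : E)) {a : E → ℝ} (ha : LocallyIntegrable a) :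
    ContDiff ℝ ∞ (mollify φ a) :=
  φ.hasCompactSupport_normed.contDiff_convolution_left _ φ.contDiff_normed ha

theorem integral_normed_sub (φ : ContDiffBump (0 : E)) (x : E) :
    ∫ t, φ.normed volume (x - t) = 1 := by
  rw [integral_sub_left_eq_self (fun t => φ.normed volume t) volume x]
  exact φ.integral_normed

/-- Jensen's inequality for mollifications. -/
theorem mollify_sq_le (φ : ContDiffBump (0 : E)) {a : E → ℝ} (ha : LocallyIntegrable a)
    (ha2 : Integrable fun x => a x ^ 2) (x : E) :
    mollify φ a x ^ 2 ≤ mollify φ (fun t => a t ^ 2) x := by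
  have h1 := integrable_normed_sub_mul φ ha x
  have h2 := integrable_normed_sub_mul φ ha2.locallyIntegrable x
  have h3 : Integrable fun t => φ.normed volume (x - t) :=
    (φ.integrable_normed (μ := volume)).comp_sub_left x
  -- Jensen for the square is nonnegativity of the variance under the probability density φ(x - ·).
  have h4 : 0 ≤ ∫ t, φ.normed volume (x - t) * (a t - mollify φ a x) ^ 2 :=
    integral_nonneg fun t => mul_nonneg (φ.nonneg_normed _) (sq_nonneg _)
  have h5 : ∀ t, φ.normed volume (x - t) * (a t - mollify φ a x) ^ 2 =
      φ.normed volume (x - t) * a t ^ 2 -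
        2 * mollify φ a x * (φ.normed volume (x - t) * a t) +
        mollify φ a x ^ 2 * φ.normed volume (x - t) := fun t => by ring
  have h6 : Integrable fun t => φ.normed volume (x - t) * a t ^ 2 -
        2 * mollify φ a x * (φ.normed volume (x - t) * a t) := h2.sub (h1.const_mul _)
  simp only [h5] at h4
  rw [integral_add h6 (h3.const_mul _), integral_sub h2 (h1.const_mul _), integral_const_mul,
    integral_const_mul, integral_normed_sub, ← mollify_apply, ← mollify_apply] at h4
  linarith

/-- Weighted `L²` bounds for mollifications. -/
theorem integral_mul_mollify_sq_le (φ : ContDiffBump (0 : E)) {a w b : E → ℝ}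
    (ha : LocallyIntegrable a) (ha2 : Integrable fun x => a x ^ 2) (hw : Continuous w)
    (hw0 : ∀ x, 0 ≤ w x) (hb : Integrable b)
    (hab : ∀ x t, ‖x - t‖ < φ.rOut → w x * a t ^ 2 ≤ b t) :
    Integrable (fun x => w x * mollify φ a x ^ 2) ∧
      ∫ x, w x * mollify φ a x ^ 2 ≤ ∫ x, b x := by
  -- After Jensen, the weight is moved inside the average over the support of the bump; the
  -- convolution then preserves the integral of b.
  have hpt : ∀ x, w x * mollify φ a x ^ 2 ≤ mollify φ b x := fun x => by
    refine (mul_le_mul_of_nonneg_left (mollify_sq_le φ ha ha2 x) (hw0 x)).trans ?_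
    rw [mollify_apply, mollify_apply, ← integral_const_mul]
    refine integral_mono ((integrable_normed_sub_mul φ ha2.locallyIntegrable x).const_mul _)
      (integrable_normed_sub_mul φ hb.locallyIntegrable x) fun t => ?_
    by_cases ht : ‖x - t‖ < φ.rOut
    · have := mul_le_mul_of_nonneg_left (hab x t ht) (φ.nonneg_normed (μ := volume) (x - t))
      simp only
      linarith
    · have h0 : φ.normed volume (x - t) = 0 := by
        rw [← Function.notMem_support, φ.support_normed_eq]
        simpa using ht
      simp [h0]
  have hbi : Integrable (mollify φ b) :=
    (φ.integrable_normed (μ := volume)).integrable_convolution _ hb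
  have hi : Integrable (fun x => w x * mollify φ a x ^ 2) := by
    refine hbi.mono' (hw.mul ((contDiff_mollify φ ha).continuous.pow 2)).aestronglyMeasurable
      (Filter.Eventually.of_forall fun x => ?_)
    rw [Real.norm_of_nonneg (mul_nonneg (hw0 x) (sq_nonneg _))]
    exact hpt x
  refine ⟨hi, (integral_mono hi hbi hpt).trans (le_of_eq ?_)⟩
  have := integral_convolution (ContinuousLinearMap.lsmul ℝ ℝ)
    (φ.integrable_normed (μ := (volume : Measure E))) hb
  rw [φ.integral_normed] at this
  simpa [mollify] using this

theorem IsWeakGradient.locallyIntegrable_apply {u : E → ℝ} {g : E → E} (h : IsWeakGradient u g)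
    (i : Fin N) : LocallyIntegrable fun x => g x i := by
  intro x
  obtain ⟨s, hs, hfs⟩ := h.locallyIntegrable_grad x
  exact ⟨s, hs, (EuclideanSpace.proj (𝕜 := ℝ) i).integrable_comp hfs⟩

/-- Mollification commutes with weak differentiation. -/
theorem IsWeakGradient.fderiv_mollify {u : E → ℝ} {g : E → E} (h : IsWeakGradient u g)
    (φ : ContDiffBump (0 : E)) (x : E) (i : Fin N) :
    fderiv ℝ (mollify φ u) x (EuclideanSpace.single i 1) = mollify φ (fun t => g t i) x := by
  have hs : ContDiff ℝ 1 (φ.normed (volume : Measure E)) := φ.contDiff_normed (n := 1)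
  have hd := φ.hasCompactSupport_normed.hasFDerivAt_convolution_left
    (ContinuousLinearMap.lsmul ℝ ℝ) hs h.locallyIntegrable_fun x
  have hex := (φ.hasCompactSupport_normed.fderiv (𝕜 := ℝ)).convolutionExists_left
    ((ContinuousLinearMap.lsmul ℝ ℝ).precompL E) (hs.continuous_fderiv one_ne_zero)
    h.locallyIntegrable_fun x
  have h1 : fderiv ℝ (mollify φ u) x (EuclideanSpace.single i 1) =
      ∫ t, u t * fderiv ℝ (φ.normed volume) (x - t) (EuclideanSpace.single i 1) := by
    rw [mollify, hd.fderiv, convolution_eq_swap,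
      ContinuousLinearMap.integral_apply hex.integrable_swap]
    congr 1; ext t
    simp [ContinuousLinearMap.precompL_apply, mul_comm]
  -- The test function is the reflected, translated bump; the sign from the reflection cancels the
  -- one in the definition of the weak gradient.
  have h2 := h.integral_eq (fun t => φ.normed volume (x - t))
    ((φ.contDiff_normed (n := ⊤)).comp (contDiff_const.sub contDiff_id))
    (φ.hasCompactSupport_normed.comp_homeomorph (Homeomorph.subLeft x)) i
  have h3 : ∀ t, fderiv ℝ (fun t => φ.normed volume (x - t)) t (EuclideanSpace.single i 1) =
      -fderiv ℝ (φ.normed volume) (x - t) (EuclideanSpace.single i 1) := fun t => by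
    have := ((hs.differentiable one_ne_zero) (x - t)).hasFDerivAt.comp t
      ((hasFDerivAt_id t).const_sub x)
    have h4 : HasFDerivAt (fun t => φ.normed volume (x - t)) _ t := this
    rw [h4.fderiv]; simp
  simp only [h3, mul_neg, integral_neg, neg_inj] at h2
  rw [h1, h2, mollify_apply]
  simp only [mul_comm]

/-! ### Cutoffs and approximation by test functions. -/

/-- A cutoff function equal to `1` on the ball of radius `n + 1`. -/
def cutoff (n : ℕ) (x : E) : ℝ :=
  (⟨1, 2, one_pos, one_lt_two⟩ : ContDiffBump (0 : E)) ((n + 1 : ℝ)⁻¹ • x)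

theorem contDiff_cutoff (n : ℕ) : ContDiff ℝ ∞ (cutoff n : E → ℝ) :=
  (ContDiffBump.contDiff _).comp (contDiff_const_smul _)

theorem hasCompactSupport_cutoff (n : ℕ) : HasCompactSupport (cutoff n : E → ℝ) :=
  (ContDiffBump.hasCompactSupport _).comp_smul (inv_ne_zero (by positivity))

theorem cutoff_mem_Icc (n : ℕ) (x : E) : cutoff n x ∈ Set.Icc (0 : ℝ) 1 :=
  ⟨ContDiffBump.nonneg _, ContDiffBump.le_one _⟩

theorem cutoff_eventually_eq_one (x : E) : ∀ᶠ n : ℕ in Filter.atTop, cutoff n x = 1 := by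
  filter_upwards [Filter.eventually_ge_atTop ⌈‖x‖⌉₊] with n hn
  refine ContDiffBump.one_of_mem_closedBall _ ?_
  rw [mem_closedBall_zero_iff, norm_smul, norm_inv, Real.norm_of_nonneg (by positivity),
    inv_mul_le_iff₀ (by positivity)]
  have := Nat.ceil_le.1 hn
  show ‖x‖ ≤ (n + 1 : ℝ) * 1
  linarith

/-- All cutoffs are dilates of one bump by n + 1, so K does not depend on n. -/
theorem exists_norm_fderiv_cutoff_le :
    ∃ K, ∀ (n : ℕ) (x : E), ‖fderiv ℝ (cutoff n) x‖ ≤ K * (1 / (n + 1 : ℝ)) := by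
  set χ : ContDiffBump (0 : E) := ⟨1, 2, one_pos, one_lt_two⟩ with hχ
  have hs : ContDiff ℝ 1 χ := χ.contDiff
  obtain ⟨K, hK⟩ := exists_bound_of_hasCompactSupport (hs.continuous_fderiv one_ne_zero)
    (χ.hasCompactSupport.fderiv ℝ)
  refine ⟨K, fun n x => ?_⟩
  have h : HasFDerivAt (cutoff n : E → ℝ) _ x :=
    ((hs.differentiable one_ne_zero) ((n + 1 : ℝ)⁻¹ • x)).hasFDerivAt.comp x
      ((hasFDerivAt_id x).const_smul (n + 1 : ℝ)⁻¹)
  rw [h.fderiv, ContinuousLinearMap.comp_smul, norm_smul, ContinuousLinearMap.comp_id, norm_inv,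
    Real.norm_of_nonneg (by positivity), mul_comm, one_div]
  exact mul_le_mul_of_nonneg_right (hK _) (by positivity)

/-- A bump function at the origin supported in the ball of radius `1 / (n + 1)`. -/
def smallBump (n : ℕ) : ContDiffBump (0 : E) :=
  ⟨1 / (n + 1) / 2, 1 / (n + 1), by positivity, half_lt_self (by positivity)⟩

/-- Truncated mollifications. -/
def truncMollify (u : E → ℝ) (n : ℕ) (x : E) : ℝ := cutoff n x * mollify (smallBump n) u x

theorem contDiff_truncMollify {u : E → ℝ} (hu : LocallyIntegrable u) (n : ℕ) :
    ContDiff ℝ ∞ (truncMollify u n) :=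
  (contDiff_cutoff n).mul (contDiff_mollify _ hu)

theorem hasCompactSupport_truncMollify (u : E → ℝ) (n : ℕ) :
    HasCompactSupport (truncMollify u n) :=
  (hasCompactSupport_cutoff n).mul_right

/-- Lebesgue differentiation, with ratio 2 between the outer and inner radii of the bumps; at each
point the cutoff is eventually 1. -/
theorem ae_tendsto_truncMollify {u : E → ℝ} (hu : LocallyIntegrable u) :
    ∀ᵐ x, Filter.Tendsto (fun n => truncMollify u n x) Filter.atTop (nhds (u x)) := by
  have h := ContDiffBump.ae_convolution_tendsto_right_of_locallyIntegrable (μ := volume)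
    (φ := fun n => smallBump (N := N) n) (l := Filter.atTop) (K := 2)
    (tendsto_one_div_add_atTop_nhds_zero_nat (𝕜 := ℝ))
    (Filter.Eventually.of_forall fun n => by simp only [smallBump]; linarith) hu
  filter_upwards [h] with x hx
  refine hx.congr' ?_
  filter_upwards [cutoff_eventually_eq_one x] with n hn
  simp [truncMollify, hn, mollify]

theorem truncMollify_sq_le (u : E → ℝ) (n : ℕ) (x : E) :
    truncMollify u n x ^ 2 ≤ mollify (smallBump n) u x ^ 2 := by
  obtain ⟨h0, h1⟩ := cutoff_mem_Icc n x
  rw [truncMollify, mul_pow]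
  exact mul_le_of_le_one_left (sq_nonneg _) (pow_le_one₀ h0 h1)

theorem integral_truncMollify_sq_le {u : E → ℝ} (hu : LocallyIntegrable u)
    (hu2 : Integrable fun x => u x ^ 2) (n : ℕ) :
    ∫ x, truncMollify u n x ^ 2 ≤ ∫ x, u x ^ 2 := by
  obtain ⟨h1, h2⟩ := integral_mul_mollify_sq_le (smallBump n) hu hu2 (w := fun _ => 1)
    continuous_const (fun _ => zero_le_one) hu2 (by simp)
  simp only [one_mul] at h1 h2
  exact (integral_mono (integrable_sq_of_hasCompactSupport (contDiff_truncMollify hu n).continuous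
    (hasCompactSupport_truncMollify u n)) h1 (truncMollify_sq_le u n)).trans h2

theorem integral_norm_sq_mul_truncMollify_sq_le {u : E → ℝ} (hu : LocallyIntegrable u)
    (hu2 : Integrable fun x => u x ^ 2) (hxu : Integrable fun x => ‖x‖ ^ 2 * u x ^ 2) (n : ℕ) :
    ∫ x, ‖x‖ ^ 2 * truncMollify u n x ^ 2 ≤
      (1 + 1 / (n + 1 : ℝ)) * (∫ x, ‖x‖ ^ 2 * u x ^ 2) +
        1 / (n + 1 : ℝ) * (2 * ∫ x, u x ^ 2) := by
  set δ : ℝ := 1 / (n + 1 : ℝ) with hδ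
  have hδ0 : 0 < δ := by positivity
  have hδ1 : δ ≤ 1 := by
    rw [hδ, div_le_one (by positivity)]
    have : (0 : ℝ) ≤ n := n.cast_nonneg
    linarith
  obtain ⟨h1, h2⟩ := integral_mul_mollify_sq_le (smallBump n) hu hu2 (w := fun x => ‖x‖ ^ 2)
    (b := fun x => (1 + δ) * (‖x‖ ^ 2 * u x ^ 2) + δ * (2 * u x ^ 2))
    (by fun_prop) (fun _ => by positivity)
    ((hxu.const_mul _).add ((hu2.const_mul 2).const_mul δ)) (by
      intro x t hxt
      have hxt' : ‖x - t‖ < δ := hxt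
      have h3 : ‖x‖ ≤ ‖t‖ + δ := by
        have := norm_le_norm_add_norm_sub' x t
        linarith
      -- From (‖t‖ + δ)² with 2δ‖t‖ ≤ δ‖t‖² + δ and δ² ≤ δ.
      have h4 : ‖x‖ ^ 2 ≤ (1 + δ) * ‖t‖ ^ 2 + δ * 2 := by
        have h5 : ‖x‖ ^ 2 ≤ (‖t‖ + δ) ^ 2 := pow_le_pow_left₀ (norm_nonneg _) h3 2
        nlinarith [mul_nonneg hδ0.le (sq_nonneg (‖t‖ - 1))]
      calc ‖x‖ ^ 2 * u t ^ 2 ≤ ((1 + δ) * ‖t‖ ^ 2 + δ * 2) * u t ^ 2 := by gcongr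
        _ = _ := by ring)
  have hc := (contDiff_truncMollify hu n).continuous
  have h6 : Integrable fun x => ‖x‖ ^ 2 * truncMollify u n x ^ 2 := by
    have h := integrable_sq_of_hasCompactSupport (a := fun x => ‖x‖ * truncMollify u n x)
      (by fun_prop) (hasCompactSupport_truncMollify u n).mul_left
    simpa only [mul_pow] using h
  refine (integral_mono h6 h1 fun x =>
    mul_le_mul_of_nonneg_left (truncMollify_sq_le u n x) (sq_nonneg _)).trans (h2.trans (le_of_eq ?_))
  rw [integral_add (hxu.const_mul _) ((hu2.const_mul 2).const_mul δ), integral_const_mul,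
    integral_const_mul, integral_const_mul]

theorem integral_fderiv_truncMollify_sq_le {u : E → ℝ} {g : E → E} (h : IsWeakGradient u g)
    (hu2 : Integrable fun x => u x ^ 2) (i : Fin N) (hg2 : Integrable fun x => g x i ^ 2)
    {K : ℝ} (hK : ∀ (n : ℕ) (x : E), ‖fderiv ℝ (cutoff n) x‖ ≤ K * (1 / (n + 1 : ℝ))) (n : ℕ) :
    ∫ x, fderiv ℝ (truncMollify u n) x (EuclideanSpace.single i 1) ^ 2 ≤
      (1 + 1 / (n + 1 : ℝ)) * (∫ x, g x i ^ 2) +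
        1 / (n + 1 : ℝ) * (2 * K ^ 2 * ∫ x, u x ^ 2) := by
  set δ : ℝ := 1 / (n + 1 : ℝ) with hδ
  have hδ0 : 0 < δ := by positivity
  have hδ1 : δ ≤ 1 := by
    rw [hδ, div_le_one (by positivity)]
    have : (0 : ℝ) ≤ n := n.cast_nonneg
    linarith
  have hu := h.locallyIntegrable_fun
  have hgi := h.locallyIntegrable_apply i
  obtain ⟨h1, h2⟩ := integral_mul_mollify_sq_le (smallBump n) hu hu2 (w := fun _ => 1)
    continuous_const (fun _ => zero_le_one) hu2 (by simp)
  obtain ⟨h3, h4⟩ := integral_mul_mollify_sq_le (smallBump n) hgi hg2 (w := fun _ => 1)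
    continuous_const (fun _ => zero_le_one) hg2 (by simp)
  simp only [one_mul] at h1 h2 h3 h4
  have hpt : ∀ x, fderiv ℝ (truncMollify u n) x (EuclideanSpace.single i 1) ^ 2 ≤
      (1 + δ) * mollify (smallBump n) (fun t => g t i) x ^ 2 +
        δ * (2 * K ^ 2) * mollify (smallBump n) u x ^ 2 := by
    intro x
    have hd : HasFDerivAt (truncMollify u n) _ x :=
      (((contDiff_cutoff n).differentiable (by simp)) x).hasFDerivAt.mul
        (((contDiff_mollify (smallBump n) hu).differentiable (by simp)) x).hasFDerivAt
    have hde : fderiv ℝ (truncMollify u n) x (EuclideanSpace.single i 1) =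
        cutoff n x * mollify (smallBump n) (fun t => g t i) x +
          mollify (smallBump n) u x * fderiv ℝ (cutoff n) x (EuclideanSpace.single i 1) := by
      rw [hd.fderiv, ← h.fderiv_mollify]; simp
    obtain ⟨hc0, hc1⟩ := cutoff_mem_Icc n x
    have hk : |fderiv ℝ (cutoff n) x (EuclideanSpace.single i 1)| ≤ K * δ := by
      have := ContinuousLinearMap.le_of_opNorm_le _ (hK n x) (EuclideanSpace.single i (1 : ℝ))
      rwa [PiLp.norm_single, norm_one, mul_one] at this
    rw [hde]
    generalize fderiv ℝ (cutoff n) x (EuclideanSpace.single i 1) = k at hk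
    generalize mollify (smallBump n) (fun t => g t i) x = a
    generalize mollify (smallBump n) u x = v
    generalize cutoff n x = c at hc0 hc1
    have hk2 : k ^ 2 ≤ K ^ 2 * δ ^ 2 := by
      rw [← mul_pow, ← sq_abs k]
      exact pow_le_pow_left₀ (abs_nonneg _) hk 2
    have hca : (c * a) ^ 2 ≤ a ^ 2 := by
      rw [mul_pow]
      exact mul_le_of_le_one_left (sq_nonneg _) (pow_le_one₀ hc0 hc1)
    -- Young's inequality with parameter δ, multiplied by δ. The factor 1 + 1/δ on the cutoff term
    -- is absorbed by k² ≤ K²δ², leaving an error of order δ.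
    have hyoung : (c * a + v * k) ^ 2 * δ ≤ ((1 + δ) * (c * a) ^ 2) * δ + (1 + δ) * (v * k) ^ 2 := by
      nlinarith [sq_nonneg (δ * (c * a) - v * k)]
    have hvk : (v * k) ^ 2 ≤ v ^ 2 * (K ^ 2 * δ ^ 2) := by
      rw [mul_pow]; gcongr
    refine le_of_mul_le_mul_right ?_ hδ0
    calc (c * a + v * k) ^ 2 * δ ≤ ((1 + δ) * (c * a) ^ 2) * δ + (1 + δ) * (v * k) ^ 2 := hyoung
      _ ≤ ((1 + δ) * a ^ 2) * δ + (1 + 1) * (v ^ 2 * (K ^ 2 * δ ^ 2)) := by gcongr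
      _ = _ := by ring
  have hcont := (contDiff_truncMollify hu n).continuous_fderiv (by simp)
  have hi := integrable_sq_of_hasCompactSupport
    (a := fun x => fderiv ℝ (truncMollify u n) x (EuclideanSpace.single i 1)) (by fun_prop)
    ((hasCompactSupport_truncMollify u n).fderiv_apply ℝ _)
  refine (integral_mono hi ((h3.const_mul _).add (h1.const_mul _)) hpt).trans ?_
  simp only [Pi.add_apply]
  rw [integral_add (h3.const_mul _) (h1.const_mul _), integral_const_mul, integral_const_mul,
    mul_assoc δ]
  gcongr

/-! ### Passage to the limit and the inequality on X. -/

/-- The stability inequality on the energy space, with a suitable multiple of the Gaussian. -/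
theorem exists_stability {u : E → ℝ} {g : E → E} (h : IsWeakGradient u g)
    (hu2 : Integrable fun x => u x ^ 2) (hg2 : ∀ i, Integrable fun x => g x i ^ 2)
    (hxu : Integrable fun x => ‖x‖ ^ 2 * u x ^ 2) :
    ∃ c : ℝ, 2 * (∫ x, (u x - c * Real.exp (-(1 / 2) * ‖x‖ ^ 2)) ^ 2) + N * ∫ x, u x ^ 2 ≤
      (∫ x, ∑ i, g x i ^ 2) + ∫ x, ‖x‖ ^ 2 * u x ^ 2 := by
  have hu := h.locallyIntegrable_fun
  obtain ⟨K, hK⟩ := exists_norm_fderiv_cutoff_le (N := N)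
  set w := truncMollify u with hw
  set G : E → ℝ := fun x => Real.exp (-(1 / 2) * ‖x‖ ^ 2) with hG
  set Z := ∫ x : E, Real.exp (-‖x‖ ^ 2) with hZ
  have hZ0 : 0 < Z := integral_exp_neg_norm_sq_pos
  have hws := contDiff_truncMollify hu
  have hwc := hasCompactSupport_truncMollify u
  set γ : ℕ → ℝ := fun n => (∫ y, w n y * G y) / Z with hγ
  have hw2 : ∀ n, Integrable fun x => w n x ^ 2 := fun n =>
    integrable_sq_of_hasCompactSupport (hws n).continuous (hwc n)
  have hwG : ∀ n, Integrable fun x => w n x * G x := fun n => by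
    have hc : HasCompactSupport fun x => w n x * G x := (hwc n).mul_right
    have := (hws n).continuous
    exact Continuous.integrable_of_hasCompactSupport (by fun_prop) hc
  -- Bessel's inequality: γₙ² Z ≤ ∫ wₙ² ≤ ∫ u².
  have hγb : ∀ n, γ n ∈ Metric.closedBall (0 : ℝ) (Real.sqrt ((∫ x, u x ^ 2) / Z)) := fun n => by
    have h1 : 0 ≤ ∫ x, (w n x - γ n * G x) ^ 2 := integral_nonneg fun x => sq_nonneg _
    rw [integral_sub_mul_exp_half_sq _ (hw2 n) (hwG n)] at h1
    have h2 : ∫ x, w n x * Real.exp (-(1 / 2) * ‖x‖ ^ 2) = γ n * Z :=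
      (div_mul_cancel₀ _ hZ0.ne').symm
    rw [h2] at h1
    have h3 := integral_truncMollify_sq_le hu hu2 n
    rw [mem_closedBall_zero_iff]
    refine Real.abs_le_sqrt ?_
    rw [le_div_iff₀ hZ0]
    change 0 ≤ _ + _ * Z at h1
    linarith
  -- A limit point of the projection coefficients suffices, since any single c bounds the infimum
  -- from above.
  obtain ⟨c, -, s, hs, hsc⟩ := tendsto_subseq_of_bounded Metric.isBounded_closedBall hγb
  refine ⟨c, ?_⟩
  set R := (∫ x, ∑ i, g x i ^ 2) + ∫ x, ‖x‖ ^ 2 * u x ^ 2 with hR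
  set C := N * (2 * K ^ 2 * ∫ x, u x ^ 2) + 2 * ∫ x, u x ^ 2 with hC
  have hGm : MemLp G 2 := (memLp_two_iff_integrable_sq (by fun_prop)).2 integrable_exp_half_sq
  have hI : ∀ n, Integrable fun x => (w n x - γ n * G x) ^ 2 := fun n =>
    (((memLp_two_iff_integrable_sq (hws n).continuous.aestronglyMeasurable).2 (hw2 n)).sub
      (hGm.const_mul (γ n))).integrable_sq
  -- The mass term N∫ wₙ² is kept on the left, so that the integrand is nonnegative and Fatou
  -- applies with almost everywhere convergence alone.
  have hbound : ∀ n, (∫ x, (2 * (w n x - γ n * G x) ^ 2 + N * w n x ^ 2)) ≤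
      (1 + 1 / (n + 1 : ℝ)) * R + 1 / (n + 1 : ℝ) * C := by
    intro n
    have hcw := (hws n).continuous
    have hcd := (hws n).continuous_fderiv (by simp)
    have h1 := stability_of_hasCompactSupport (hws n) (hwc n)
    have h2 : ∫ x, ∑ i, fderiv ℝ (w n) x (EuclideanSpace.single i 1) ^ 2 ≤
        (1 + 1 / (n + 1 : ℝ)) * (∫ x, ∑ i, g x i ^ 2) +
          1 / (n + 1 : ℝ) * (N * (2 * K ^ 2 * ∫ x, u x ^ 2)) := by
      rw [integral_finsetSum _ fun i _ => hg2 i, integral_finsetSum _ fun i _ =>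
        integrable_sq_of_hasCompactSupport (by fun_prop) ((hwc n).fderiv_apply ℝ _)]
      refine (Finset.sum_le_sum fun i _ =>
        integral_fderiv_truncMollify_sq_le h hu2 i (hg2 i) hK n).trans (le_of_eq ?_)
      rw [Finset.sum_add_distrib, ← Finset.mul_sum, Finset.sum_const, Finset.card_univ,
        Fintype.card_fin, nsmul_eq_mul]
      ring
    have h3 := integral_norm_sq_mul_truncMollify_sq_le hu hu2 hxu n
    rw [integral_add ((hI n).const_mul 2) ((hw2 n).const_mul _), integral_const_mul,
      integral_const_mul]
    refine h1.trans ((add_le_add h2 h3).trans (le_of_eq ?_))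
    rw [hR, hC]; ring
  have hδ : Filter.Tendsto (fun n : ℕ => 1 / (n + 1 : ℝ)) Filter.atTop (nhds 0) :=
    tendsto_one_div_add_atTop_nhds_zero_nat
  have hlim : Filter.Tendsto (fun n : ℕ => (1 + 1 / (n + 1 : ℝ)) * R + 1 / (n + 1 : ℝ) * C)
      Filter.atTop (nhds R) := by
    have := ((hδ.const_add 1).mul_const R).add (hδ.mul_const C)
    simpa using this
  set Φ : ℕ → E → ℝ := fun n x => 2 * (w n x - γ n * G x) ^ 2 + N * w n x ^ 2 with hΦ
  have hΦ0 : ∀ n x, 0 ≤ Φ n x := fun n x => by simp only [hΦ]; positivity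
  have hΦi : ∀ n, Integrable (Φ n) := fun n => ((hI n).const_mul 2).add ((hw2 n).const_mul _)
  have hFatou := lintegral_liminf_le' (μ := volume) (u := Filter.atTop)
    (f := fun n x => ENNReal.ofReal (Φ (s n) x))
    fun n => (hΦi (s n)).aestronglyMeasurable.aemeasurable.ennreal_ofReal
  have hle : Filter.liminf (fun n => ∫⁻ x, ENNReal.ofReal (Φ (s n) x)) Filter.atTop ≤
      ENNReal.ofReal R := by
    have hl2 := (ENNReal.tendsto_ofReal (hlim.comp hs.tendsto_atTop)).liminf_eq
    rw [← hl2]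
    refine Filter.liminf_le_liminf (Filter.Eventually.of_forall fun n => ?_)
    rw [← ofReal_integral_eq_lintegral_ofReal (hΦi (s n))
      (Filter.Eventually.of_forall (hΦ0 (s n)))]
    exact ENNReal.ofReal_le_ofReal (hbound (s n))
  have hae : (fun x => ENNReal.ofReal (2 * (u x - c * G x) ^ 2 + N * u x ^ 2)) =ᵐ[volume]
      fun x => Filter.liminf (fun n => ENNReal.ofReal (Φ (s n) x)) Filter.atTop := by
    filter_upwards [ae_tendsto_truncMollify hu] with x hx
    have hx' := hx.comp hs.tendsto_atTop
    refine (Filter.Tendsto.liminf_eq ?_).symm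
    refine ENNReal.tendsto_ofReal ?_
    exact (((hx'.sub (hsc.mul_const (G x))).pow 2).const_mul 2).add ((hx'.pow 2).const_mul _)
  rw [← lintegral_congr_ae hae] at hFatou
  have huG : MemLp u 2 :=
    (memLp_two_iff_integrable_sq hu.aestronglyMeasurable).2 hu2
  have hIu : Integrable fun x => (u x - c * G x) ^ 2 := (huG.sub (hGm.const_mul c)).integrable_sq
  have hIt : Integrable fun x => 2 * (u x - c * G x) ^ 2 + N * u x ^ 2 :=
    (hIu.const_mul 2).add (hu2.const_mul _)
  rw [← ofReal_integral_eq_lintegral_ofReal hIt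
    (Filter.Eventually.of_forall fun x => by positivity)] at hFatou
  have hR0 : 0 ≤ R := add_nonneg
    (integral_nonneg fun x => Finset.sum_nonneg fun i _ => sq_nonneg _)
    (integral_nonneg fun x => by positivity)
  have hfin := (ENNReal.ofReal_le_ofReal_iff hR0).1 (hFatou.trans hle)
  rwa [integral_add (hIu.const_mul 2) (hu2.const_mul _), integral_const_mul,
    integral_const_mul] at hfin

theorem gaussianDistSq_le (u : E → ℝ) (c : ℝ) :
    gaussianDistSq u ≤ ∫ x, (u x - c * Real.exp (-(1 / 2) * ‖x‖ ^ 2)) ^ 2 := by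
  have h := ciInf_le (f := fun c : ℝ =>
    ∫ x, |u x - c * Real.exp (-(1 / 2) * ‖x‖ ^ 2)| ^ 2)
    ⟨0, by rintro _ ⟨c, rfl⟩; exact integral_nonneg fun x => by positivity⟩ c
  simpa only [gaussianDistSq, sq_abs] using h

theorem two_mul_gaussianDistSq_le_deficit {u : E → ℝ} (hu : u ∈ X N) :
    2 * gaussianDistSq u ≤ deficit u := by
  obtain ⟨hW, hxu⟩ := hu
  have hg := memLp_weakGradient hW
  have hgi : ∀ i, Integrable fun x => weakGradient u x i ^ 2 := fun i => by
    have : MemLp (fun x => weakGradient u x i) 2 :=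
      (EuclideanSpace.proj (𝕜 := ℝ) i).comp_memLp' hg
    exact this.integrable_sq
  simp only [sq_abs] at hxu
  obtain ⟨c, hc⟩ := exists_stability (isWeakGradient_weakGradient hW) hW.1.integrable_sq hgi hxu
  have h := gaussianDistSq_le u c
  simp only [deficit, sq_abs, EuclideanSpace.norm_sq_eq, Real.norm_eq_abs] at hc h ⊢
  linarith

/-! ### Classical gradients as weak gradients. -/

/-- The classical gradient, in coordinates. -/
def classicalGradient (u : E → ℝ) (x : E) : E :=
  WithLp.toLp 2 fun i => fderiv ℝ u x (EuclideanSpace.single i 1)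

theorem norm_classicalGradient_sq (u : E → ℝ) (x : E) :
    ‖classicalGradient u x‖ ^ 2 = ∑ i, fderiv ℝ u x (EuclideanSpace.single i 1) ^ 2 := by
  simp [EuclideanSpace.norm_sq_eq, classicalGradient]

theorem continuous_classicalGradient {u : E → ℝ} (hu : ContDiff ℝ 1 u) :
    Continuous (classicalGradient u) := by
  have := hu.continuous_fderiv one_ne_zero
  unfold classicalGradient
  fun_prop

theorem isWeakGradient_classicalGradient {u : E → ℝ} (hu : ContDiff ℝ 1 u) :
    IsWeakGradient u (classicalGradient u) where
  locallyIntegrable_fun := hu.continuous.locallyIntegrable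
  locallyIntegrable_grad := (continuous_classicalGradient hu).locallyIntegrable
  integral_eq φ hφ hc i := by
    have hu1 := hu.continuous_fderiv one_ne_zero
    have huc := hu.continuous
    have hφ1 := hφ.continuous_fderiv (by simp)
    have hφc := hφ.continuous
    have h1 : HasCompactSupport fun x => fderiv ℝ u x (EuclideanSpace.single i 1) * φ x :=
      hc.mul_left
    have h2 : HasCompactSupport fun x => u x * fderiv ℝ φ x (EuclideanSpace.single i 1) :=
      (hc.fderiv_apply ℝ _).mul_left
    have h3 : HasCompactSupport fun x => u x * φ x := hc.mul_left
    exact integral_mul_fderiv_eq_neg_fderiv_mul_of_integrable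
      (Continuous.integrable_of_hasCompactSupport (by fun_prop) h1)
      (Continuous.integrable_of_hasCompactSupport (by fun_prop) h2)
      (Continuous.integrable_of_hasCompactSupport (by fun_prop) h3)
      (fun x _ => hu.differentiable one_ne_zero x)
      (fun x _ => hφ.differentiable (by simp) x)

theorem memW12_of_contDiff {u : E → ℝ} (hu : ContDiff ℝ 1 u) (h0 : Integrable fun x => u x ^ 2)
    (hd : ∀ i, Integrable fun x => fderiv ℝ u x (EuclideanSpace.single i 1) ^ 2) : MemW12 u := by
  refine ⟨(memLp_two_iff_integrable_sq hu.continuous.aestronglyMeasurable).2 h0,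
    classicalGradient u, ?_, isWeakGradient_classicalGradient hu⟩
  rw [memLp_two_iff_integrable_sq_norm (continuous_classicalGradient hu).aestronglyMeasurable]
  simp only [norm_classicalGradient_sq]
  exact integrable_finsetSum _ fun i _ => hd i

/-- The deficit of a smooth function is the energy of `∇u + xu`. -/
theorem deficit_eq_of_contDiff {u : E → ℝ} (hu : ContDiff ℝ 1 u)
    (h0 : Integrable fun x => u x ^ 2) (hx : ∀ i, Integrable fun x => (x i * u x) ^ 2)
    (hd : ∀ i, Integrable fun x => fderiv ℝ u x (EuclideanSpace.single i 1) ^ 2) :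
    deficit u = ∑ i, ∫ x, (fderiv ℝ u x (EuclideanSpace.single i 1) + x i * u x) ^ 2 := by
  have hae := (isWeakGradient_weakGradient (memW12_of_contDiff hu h0 hd)).ae_eq
    (isWeakGradient_classicalGradient hu)
  have h1 : ∫ x, ‖weakGradient u x‖ ^ 2 =
      ∫ x, ∑ i, fderiv ℝ u x (EuclideanSpace.single i 1) ^ 2 := by
    refine integral_congr_ae ?_
    filter_upwards [hae] with x hx
    rw [hx, norm_classicalGradient_sq]
  rw [integral_sum_fderiv_add_mul_sq hu h0 hx hd, deficit, h1]
  simp only [sq_abs]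

/-! ### The extremal function x_k e^{-|x|²/2}. -/

theorem contDiff_exp_half_sq {n : WithTop ℕ∞} :
    ContDiff ℝ n fun x : E => Real.exp (-(1 / 2) * ‖x‖ ^ 2) :=
  (contDiff_const.mul (contDiff_norm_sq ℝ)).exp

theorem fderiv_exp_half_sq (x : E) (i : Fin N) :
    fderiv ℝ (fun x : E => Real.exp (-(1 / 2) * ‖x‖ ^ 2)) x (EuclideanSpace.single i 1) =
      -(x i * Real.exp (-(1 / 2) * ‖x‖ ^ 2)) := by
  have h1 : HasFDerivAt (fun x : E => Real.exp (-(1 / 2) * ‖x‖ ^ 2)) _ x :=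
    (((hasFDerivAt_id x).norm_sq).const_mul (-(1 / 2))).exp
  rw [h1.fderiv]
  simp [EuclideanSpace.inner_single_right]
  ring

theorem contDiff_coord_mul_exp_half_sq {n : WithTop ℕ∞} (k : Fin N) :
    ContDiff ℝ n fun x : E => x k * Real.exp (-(1 / 2) * ‖x‖ ^ 2) :=
  (EuclideanSpace.proj k : E →L[ℝ] ℝ).contDiff.mul contDiff_exp_half_sq

theorem fderiv_coord_mul_exp_half_sq (k i : Fin N) (x : E) :
    fderiv ℝ (fun x : E => x k * Real.exp (-(1 / 2) * ‖x‖ ^ 2)) x (EuclideanSpace.single i 1) =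
      ((if k = i then 1 else 0) - x i * x k) * Real.exp (-(1 / 2) * ‖x‖ ^ 2) := by
  have h1 : HasFDerivAt (fun x : E => x k * Real.exp (-(1 / 2) * ‖x‖ ^ 2)) _ x :=
    (EuclideanSpace.proj k : E →L[ℝ] ℝ).hasFDerivAt.mul
      (contDiff_exp_half_sq.differentiable one_ne_zero x).hasFDerivAt
  rw [h1.fderiv, add_apply, smul_apply, fderiv_exp_half_sq]
  split_ifs <;> simp [*] <;> ring

theorem integrable_sq_mul_exp_half_sq {Φ : E → ℝ} (hΦ : Continuous Φ)
    (hb : ∀ x, |Φ x| ≤ 1 + ‖x‖ ^ 2) :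
    Integrable fun x => (Φ x * Real.exp (-(1 / 2) * ‖x‖ ^ 2)) ^ 2 := by
  simp only [mul_pow, exp_half_sq]
  refine integrable_mul_exp_neg_norm_sq (by fun_prop) (C := 1) 2 fun x => ?_
  rw [abs_pow, one_mul]
  exact pow_le_pow_left₀ (abs_nonneg _) (hb x) 2

theorem abs_coord_le (x : E) (i : Fin N) : |x i| ≤ ‖x‖ := PiLp.norm_apply_le x i

theorem abs_coord_mul_coord_le (x : E) (i k : Fin N) : |x i * x k| ≤ ‖x‖ ^ 2 := by
  rw [abs_mul, sq]
  exact mul_le_mul (abs_coord_le x i) (abs_coord_le x k) (abs_nonneg _) (norm_nonneg _)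

theorem integrable_coord_mul_exp_half_sq_sq (k : Fin N) :
    Integrable fun x : E => (x k * Real.exp (-(1 / 2) * ‖x‖ ^ 2)) ^ 2 :=
  integrable_sq_mul_exp_half_sq (by fun_prop) fun x => by
    nlinarith [abs_coord_le x k, sq_nonneg (‖x‖ - 1)]

theorem integrable_coord_mul_coord_mul_exp_half_sq_sq (k i : Fin N) :
    Integrable fun x : E => (x i * (x k * Real.exp (-(1 / 2) * ‖x‖ ^ 2))) ^ 2 := by
  simp only [← mul_assoc]
  exact integrable_sq_mul_exp_half_sq (by fun_prop) fun x => by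
    linarith [abs_coord_mul_coord_le x i k]

theorem integrable_fderiv_coord_mul_exp_half_sq_sq (k i : Fin N) :
    Integrable fun x : E => fderiv ℝ (fun x : E => x k * Real.exp (-(1 / 2) * ‖x‖ ^ 2)) x
      (EuclideanSpace.single i 1) ^ 2 := by
  simp only [fderiv_coord_mul_exp_half_sq]
  refine integrable_sq_mul_exp_half_sq (by fun_prop) fun x => ?_
  refine (abs_sub _ _).trans (add_le_add ?_ (abs_coord_mul_coord_le x i k))
  split_ifs <;> simp

/-- The energy identity applied to G itself, where ∂_k G + x_k G = 0, reads 0 = 2∫ (x_k G)² - ∫ G².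
-/
theorem integral_coord_mul_exp_half_sq_sq (k : Fin N) :
    ∫ x : E, (x k * Real.exp (-(1 / 2) * ‖x‖ ^ 2)) ^ 2 =
      (∫ x : E, Real.exp (-‖x‖ ^ 2)) / 2 := by
  have h := integral_fderiv_add_mul_sq contDiff_exp_half_sq k integrable_exp_half_sq
    (integrable_coord_mul_exp_half_sq_sq k) (by
      simp only [fderiv_exp_half_sq, neg_sq]
      exact integrable_coord_mul_exp_half_sq_sq k)
  simp only [fderiv_exp_half_sq, neg_sq, neg_add_cancel, exp_half_sq] at h
  norm_num at h ⊢
  linarith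

/-- The integrand is odd. -/
theorem integral_coord_mul_exp_half_sq_mul (k : Fin N) :
    ∫ x : E, x k * Real.exp (-(1 / 2) * ‖x‖ ^ 2) * Real.exp (-(1 / 2) * ‖x‖ ^ 2) = 0 := by
  have h := integral_neg_eq_self
    (fun x : E => x k * Real.exp (-(1 / 2) * ‖x‖ ^ 2) * Real.exp (-(1 / 2) * ‖x‖ ^ 2)) volume
  simp only [PiLp.neg_apply, norm_neg, neg_mul (_ : ℝ) (Real.exp _), integral_neg] at h
  linarith

/-- By orthogonality to the Gaussian, the infimum is attained at c = 0. -/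
theorem gaussianDistSq_coord_mul_exp_half_sq (k : Fin N) :
    gaussianDistSq (fun x : E => x k * Real.exp (-(1 / 2) * ‖x‖ ^ 2)) =
      (∫ x : E, Real.exp (-‖x‖ ^ 2)) / 2 := by
  have hGm : MemLp (fun x : E => Real.exp (-(1 / 2) * ‖x‖ ^ 2)) 2 :=
    (memLp_two_iff_integrable_sq (by fun_prop)).2 integrable_exp_half_sq
  have hum : MemLp (fun x : E => x k * Real.exp (-(1 / 2) * ‖x‖ ^ 2)) 2 :=
    (memLp_two_iff_integrable_sq (by fun_prop)).2 (integrable_coord_mul_exp_half_sq_sq k)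
  have hd : ∀ c : ℝ, ∫ x : E, (x k * Real.exp (-(1 / 2) * ‖x‖ ^ 2) -
      c * Real.exp (-(1 / 2) * ‖x‖ ^ 2)) ^ 2 =
      (∫ x : E, Real.exp (-‖x‖ ^ 2)) / 2 + c ^ 2 * ∫ x : E, Real.exp (-‖x‖ ^ 2) := fun c => by
    rw [integral_sub_mul_exp_half_sq c (integrable_coord_mul_exp_half_sq_sq k)
      (hum.integrable_mul hGm), integral_coord_mul_exp_half_sq_sq,
      integral_coord_mul_exp_half_sq_mul]
    ring
  refine le_antisymm ((gaussianDistSq_le _ 0).trans (by rw [hd]; simp)) (le_ciInf fun c => ?_)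
  simp only [sq_abs]
  rw [hd]
  have := integral_exp_neg_norm_sq_pos (N := N)
  have : 0 ≤ c ^ 2 * ∫ x : E, Real.exp (-‖x‖ ^ 2) := by positivity
  linarith

/-- In ∂ᵢ + xᵢ applied to x_k G the quadratic terms cancel, so only the coordinate i = k
contributes. -/
theorem deficit_coord_mul_exp_half_sq (k : Fin N) :
    deficit (fun x : E => x k * Real.exp (-(1 / 2) * ‖x‖ ^ 2)) =
      ∫ x : E, Real.exp (-‖x‖ ^ 2) := by
  rw [deficit_eq_of_contDiff (contDiff_coord_mul_exp_half_sq k)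
    (integrable_coord_mul_exp_half_sq_sq k) (integrable_coord_mul_coord_mul_exp_half_sq_sq k)
    (integrable_fderiv_coord_mul_exp_half_sq_sq k)]
  have h : ∀ (i : Fin N) (x : E),
      (fderiv ℝ (fun x : E => x k * Real.exp (-(1 / 2) * ‖x‖ ^ 2)) x (EuclideanSpace.single i 1) +
        x i * (x k * Real.exp (-(1 / 2) * ‖x‖ ^ 2))) ^ 2 =
      if k = i then Real.exp (-‖x‖ ^ 2) else 0 := fun i x => by
    rw [fderiv_coord_mul_exp_half_sq, ← exp_half_sq]
    split_ifs <;> ring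
  simp only [h]
  rw [Finset.sum_eq_single k (fun i _ hi => by simp [hi.symm]) (by simp)]
  simp

theorem coord_mul_exp_half_sq_mem_X (k : Fin N) :
    (fun x : E => x k * Real.exp (-(1 / 2) * ‖x‖ ^ 2)) ∈ X N := by
  refine ⟨memW12_of_contDiff (contDiff_coord_mul_exp_half_sq k)
    (integrable_coord_mul_exp_half_sq_sq k) (integrable_fderiv_coord_mul_exp_half_sq_sq k), ?_⟩
  simp only [sq_abs, norm_sq_mul_sq]
  exact integrable_finsetSum _ fun i _ => integrable_coord_mul_coord_mul_exp_half_sq_sq k i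

end HUP

end

/-- The stability of the scale non-invariant Heisenberg uncertainty principle: the inequality with
constant `2` on `X`, the optimality of that constant, and equality, with both sides positive, for
`x₁ e^{-|x|²/2}`, which lies in `X`. -/
theorem theorem3p1 (N : ℕ) (hN : 0 < N) :
    (∀ u ∈ HUP.X N, HUP.deficit u ≥ 2 * HUP.gaussianDistSq u) ∧
    (∀ C : ℝ, (∀ u ∈ HUP.X N, HUP.deficit u ≥ C * HUP.gaussianDistSq u) → C ≤ 2) ∧
    (∀ u₁ : EuclideanSpace ℝ (Fin N) → ℝ,
      u₁ = (fun x => x ⟨0, hN⟩ * Real.exp (-(1 / 2) * ‖x‖ ^ 2)) →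
      u₁ ∈ HUP.X N ∧ 0 < HUP.gaussianDistSq u₁ ∧
        HUP.deficit u₁ = 2 * HUP.gaussianDistSq u₁) := by
  have hZ := HUP.integral_exp_neg_norm_sq_pos (N := N)
  refine ⟨fun u hu => HUP.two_mul_gaussianDistSq_le_deficit hu, fun C hC => ?_, ?_⟩
  · have h := hC _ (HUP.coord_mul_exp_half_sq_mem_X ⟨0, hN⟩)
    rw [HUP.deficit_coord_mul_exp_half_sq, HUP.gaussianDistSq_coord_mul_exp_half_sq] at h
    refine le_of_mul_le_mul_right (a := (∫ x : EuclideanSpace ℝ (Fin N),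
      Real.exp (-‖x‖ ^ 2)) / 2) ?_ (by positivity)
    linarith
  · rintro _ rfl
    refine ⟨HUP.coord_mul_exp_half_sq_mem_X _, ?_, ?_⟩
    · rw [HUP.gaussianDistSq_coord_mul_exp_half_sq]
      positivity
    · rw [HUP.deficit_coord_mul_exp_half_sq, HUP.gaussianDistSq_coord_mul_exp_half_sq]
      ring
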